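/- Let $\varepsilon>0$ and $\lambda>\lambda_0:=3/2^{2/3}$, and consider the equation $$\varepsilon^2u''=u^3-\lambda u+\cos t.\qquad(1.1)$$ Let $b>0$ satisfy $b^3-\lambda b-1>0$ and let $\alpha_0$ be the smallest root of $x^3-\lambda x+1=0$. Assume Condition A: there is an $\bar\alpha\in(\alpha_0,-\sqrt{\lambda/3})$ such that the solution $u$ of (1.1) with $u(0)=\bar\alpha$, $u'(0)=0$ is strictly increasing from $t=0$ until it reaches the value $b$, at some time $T<\pi/2$. Then (1.1) has (at least) five $2\pi$-periodic solutions $u_1,\dots,u_5$ on $\mathbb R$, all satisfying $u_i'(0)=u_i'(\pi)=0$, with $$u_1(t)<u_2(t)<u_3(t)<u_4(t)<u_5(t)\quad\text{for all }t\in\mathbb R .$$ Here $u_1$ is the unique solution bounded on $\mathbb R$ with $u<0$ and $3u^2-\lambda>0$ everywhere, $u_5$ is the unique solution bounded on $\mathbb R$ with $u>0$ and $3u^2-\lambda>0$ everywhere, $u_3=u_p$ is the unique solution on $\mathbb R$ with $u'(0)=0$, $u(\pi/2)=0$ and $u'>0$ on $(0,\pi/2)$, and $u_4(t)=-u_2(t+\pi)$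 for all $t$. -/

import Mathlib

noncomputable section

namespace Duffing

/-- `u` satisfies `ε² u'' = u³ - lam * u + cos t` on the set `s`, with `u'` its first derivative
(one-sided at the end points when `s` is a closed interval). Used with `ε > 0`. -/
def IsSolutionOn (ε lam : ℝ) (s : Set ℝ) (u u' : ℝ → ℝ) : Prop :=
  ∀ t ∈ s, HasDerivWithinAt u (u' t) s t ∧
    HasDerivWithinAt u' ((u t ^ 3 - lam * u t + Real.cos t) / ε ^ 2) s t

/-- `u` is a solution of `ε² u'' = u³ - lam * u + cos t` on the whole real line. -/
def IsSolution (ε lam : ℝ) (u : ℝ → ℝ) : Prop :=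
  IsSolutionOn ε lam Set.univ u (deriv u)

/-- A solution bounded on the whole line. -/
def IsBoundedSolution (ε lam : ℝ) (u : ℝ → ℝ) : Prop :=
  IsSolution ε lam u ∧ ∃ M : ℝ, ∀ t, |u t| ≤ M

/-- The smallest root of `x³ - lam * x + 1 = 0`. -/
def alpha0 (lam : ℝ) : ℝ := sInf {x : ℝ | x ^ 3 - lam * x + 1 = 0}

/-- Condition A: for some `a` strictly between `alpha0 lam` and `-√(lam/3)`, the solution with
`u 0 = a`, `u' 0 = 0` increases from time `0` until it reaches the height `b`,
which happens at a time `T < π/2`. -/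
def ConditionA (ε lam b : ℝ) : Prop :=
  ∃ a ∈ Set.Ioo (alpha0 lam) (-Real.sqrt (lam / 3)), ∃ T ∈ Set.Ioo 0 (Real.pi / 2),
    ∃ u u' : ℝ → ℝ, IsSolutionOn ε lam (Set.Icc 0 T) u u' ∧ u 0 = a ∧ u' 0 = 0 ∧
      StrictMonoOn u (Set.Icc 0 T) ∧ u T = b

/-- The bounded solution with `u < 0` and `3u² - lam > 0`. -/
def IsLowerSolution (ε lam : ℝ) (u : ℝ → ℝ) : Prop :=
  IsBoundedSolution ε lam u ∧ ∀ t, u t < 0 ∧ 0 < 3 * u t ^ 2 - lam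

/-- The bounded solution with `u > 0` and `3u² - lam > 0`. -/
def IsUpperSolution (ε lam : ℝ) (u : ℝ → ℝ) : Prop :=
  IsBoundedSolution ε lam u ∧ ∀ t, 0 < u t ∧ 0 < 3 * u t ^ 2 - lam

/-- The solution `u_p`: `u'(0) = 0`, `u(π/2) = 0` and `u' > 0` on `(0, π/2)`. -/
def IsMiddleSolution (ε lam : ℝ) (u : ℝ → ℝ) : Prop :=
  IsSolution ε lam u ∧ deriv u 0 = 0 ∧ u (Real.pi / 2) = 0 ∧
    ∀ t ∈ Set.Ioo 0 (Real.pi / 2), 0 < deriv u t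

end Duffing

end

/-! Everything is shooting from `t = 0` with zero slope. The force is frozen outside a strip, which
makes it bounded and globally Lipschitz: solutions then exist for all time and depend continuously
on `u(0)`. At the edges of the strip the force drives solutions outward (`escape`), so a solution
that leaves cannot meet the target condition at the far end. A shot that meets it has therefore
stayed inside and solves the true equation.

The upper solution lives between a constant `m` just above `√(lam/3)` and `b`, with target `u'(π) =
0`. The middle one is shot to `u(π/2) = 0` and continued by oddness about `π/2`. Zero slope at `0`
and `π` makes solutions even about both points, hence `2π`-periodic.

The fourth solution is shot between the middle and upper ones. Just below the upper solution the
force increases in `u`, so shots fall away and `u'(π) ≤ 0`. The start from Condition A produces a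
solution that meets the upper one, which forces `u'(π) ≥ 0`. The intermediate value theorem gives a
start between the two. That the Condition A solution stays above the middle one is the Wronskian
comparison `le_of_negative_solutions`, which also gives uniqueness of the middle solution. The upper
solution is unique because the squared difference of two candidates is convex and bounded.

The order-reversing symmetry `u ↦ -u(· + π)` supplies the two remaining solutions. -/

namespace Duffing

open Set Filter Topology

/-! ### Global existence, uniqueness and continuous dependence -/

/-- `u'' = f(t, u)` on the whole line, with `u'` the derivative of `u`. -/
def IsGlobalSolution (f : ℝ → ℝ → ℝ) (u u' : ℝ → ℝ) : Prop :=
  ∀ t, HasDerivAt u (u' t) t ∧ HasDerivAt u' (f t (u t)) t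

/-- A continuous bounded right-hand side, Lipschitz in the second variable. -/
structure IsTame (f : ℝ → ℝ → ℝ) (K : ℝ) : Prop where
  continuous : Continuous (Function.uncurry f)
  nonneg : 0 ≤ K
  lipschitz : ∀ t x y, |f t x - f t y| ≤ K * |x - y|
  bounded : ∃ B, ∀ t x, |f t x| ≤ B

/-- First-order Gronwall for the pair `(d, d')` in the sup norm; in the rate `K + 1` the `1` absorbs
`d'` and the `K` absorbs `d''`. -/
theorem abs_le_gronwall {d d' d'' : ℝ → ℝ} {K a b δ : ℝ} (hK : 0 ≤ K)
    (hd : ∀ t ∈ Icc a b, HasDerivWithinAt d (d' t) (Icc a b) t)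
    (hd' : ∀ t ∈ Icc a b, HasDerivWithinAt d' (d'' t) (Icc a b) t)
    (hb : ∀ t ∈ Icc a b, |d'' t| ≤ K * |d t|) (h0 : |d a| ≤ δ) (h0' : |d' a| ≤ δ) :
    ∀ t ∈ Icc a b, |d t| ≤ δ * Real.exp ((K + 1) * (t - a)) ∧
      |d' t| ≤ δ * Real.exp ((K + 1) * (t - a)) := by
  have key := norm_le_gronwallBound_of_norm_deriv_right_le (f := fun t => (d t, d' t))
    (f' := fun t => (d' t, d'' t)) (δ := δ) (K := K + 1) (ε := 0) (a := a) (b := b)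
    (fun t ht => ((hd t ht).continuousWithinAt).prodMk ((hd' t ht).continuousWithinAt))
    (fun t ht => ((hd t (Ico_subset_Icc_self ht)).prodMk
      (hd' t (Ico_subset_Icc_self ht))).mono_of_mem_nhdsWithin (Icc_mem_nhdsGE_of_mem ht))
    (by simpa [Prod.norm_def] using ⟨h0, h0'⟩)
    (fun t ht => by
      have h1 := hb t (Ico_subset_Icc_self ht)
      simp only [Prod.norm_def, Real.norm_eq_abs, add_zero]
      have h2 := le_max_left |d t| |d' t|
      have h3 := le_max_right |d t| |d' t|
      have h4 := abs_nonneg (d t)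
      have h5 := mul_le_mul_of_nonneg_left h2 hK
      have h6 := mul_nonneg hK (h4.trans h2)
      apply max_le <;> linarith)
  intro t ht
  have := key t ht
  rw [gronwallBound_ε0, Prod.norm_def] at this
  exact ⟨(le_max_left _ _).trans this, (le_max_right _ _).trans this⟩

theorem eq_of_gronwall {d d' d'' : ℝ → ℝ} {K a b : ℝ} (hK : 0 ≤ K)
    (hd : ∀ t ∈ Icc a b, HasDerivWithinAt d (d' t) (Icc a b) t)
    (hd' : ∀ t ∈ Icc a b, HasDerivWithinAt d' (d'' t) (Icc a b) t)
    (hb : ∀ t ∈ Icc a b, |d'' t| ≤ K * |d t|) (h0 : d a = 0) (h0' : d' a = 0) :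
    ∀ t ∈ Icc a b, d t = 0 ∧ d' t = 0 := by
  intro t ht
  have := abs_le_gronwall (δ := 0) hK hd hd' hb (by simp [h0]) (by simp [h0']) t ht
  simpa using this

theorem HasDerivAt.comp_neg_left {g : ℝ → ℝ} {g' t : ℝ} (c : ℝ) (h : HasDerivAt g g' (c - t)) :
    HasDerivAt (fun s => g (c - s)) (-g') t := by
  simpa [Function.comp_def] using h.comp t ((hasDerivAt_id t).const_sub c)

/-- The constant may depend on the time window, so this also serves the cubic force, which is only
locally Lipschitz. Backward time is reduced to forward time by reflection. -/
theorem eq_zero_of_abs_deriv2_le {d d' d'' : ℝ → ℝ}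
    (hd : ∀ t, HasDerivAt d (d' t) t) (hd' : ∀ t, HasDerivAt d' (d'' t) t)
    (hb : ∀ R, ∃ K, 0 ≤ K ∧ ∀ t, |t| ≤ R → |d'' t| ≤ K * |d t|) {s : ℝ}
    (h0 : d s = 0) (h0' : d' s = 0) (t : ℝ) : d t = 0 ∧ d' t = 0 := by
  obtain ⟨K, hK, hb⟩ := hb (|s| + |t|)
  rcases le_total s t with hst | hst
  · refine eq_of_gronwall hK (fun x _ => (hd x).hasDerivWithinAt)
      (fun x _ => (hd' x).hasDerivWithinAt) (fun x hx => hb x ?_) h0 h0' t ⟨hst, le_rfl⟩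
    rw [abs_le]
    constructor
    · linarith [hx.1, neg_abs_le s, abs_nonneg t]
    · linarith [hx.2, le_abs_self t, abs_nonneg s]
  · have := eq_of_gronwall (d := fun x => d (0 - x)) (d' := fun x => -d' (0 - x))
      (d'' := fun x => d'' (0 - x)) (a := -s) (b := -t) hK
      (fun x _ => (HasDerivAt.comp_neg_left 0 (hd _)).hasDerivWithinAt)
      (fun x _ => by
        simpa using (HasDerivAt.comp_neg_left 0 (hd' (0 - x))).fun_neg.hasDerivWithinAt)
      (fun x hx => hb _ ?_) (by simpa using h0) (by simpa using h0') (-t)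
      ⟨neg_le_neg hst, le_rfl⟩
    · simpa using this
    · rw [abs_le]
      constructor
      · linarith [hx.2, neg_abs_le t, abs_nonneg s]
      · linarith [hx.1, le_abs_self s, abs_nonneg t]

theorem IsGlobalSolution.eq_of_isTame {f : ℝ → ℝ → ℝ} {K : ℝ} (hf : IsTame f K)
    {u u' v v' : ℝ → ℝ} (hu : IsGlobalSolution f u u') (hv : IsGlobalSolution f v v') {s : ℝ}
    (h0 : u s = v s) (h0' : u' s = v' s) (t : ℝ) : u t = v t ∧ u' t = v' t := by
  have := eq_zero_of_abs_deriv2_le (d := fun t => u t - v t) (d' := fun t => u' t - v' t)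
    (d'' := fun t => f t (u t) - f t (v t)) (fun t => (hu t).1.sub (hv t).1)
    (fun t => (hu t).2.sub (hv t).2) (fun R => ⟨K, hf.nonneg, fun t _ => hf.lipschitz _ _ _⟩)
    (s := s) (by simp [h0]) (by simp [h0']) t
  exact ⟨sub_eq_zero.1 this.1, sub_eq_zero.1 this.2⟩

theorem IsGlobalSolution.comp_reflect {f : ℝ → ℝ → ℝ} {u u' : ℝ → ℝ} (hu : IsGlobalSolution f u u')
    {c : ℝ} (hc : ∀ t x, f (2 * c - t) x = f t x) :
    IsGlobalSolution f (fun t => u (2 * c - t)) (fun t => -u' (2 * c - t)) := by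
  intro t
  refine ⟨HasDerivAt.comp_neg_left _ (hu _).1, ?_⟩
  have := (HasDerivAt.comp_neg_left (t := t) (2 * c) (hu _).2).fun_neg
  simpa [hc] using this

/-- The solution and its mirror image share value and slope at the axis exactly when the slope there
vanishes; uniqueness does the rest. -/
theorem IsGlobalSolution.reflect_eq {f : ℝ → ℝ → ℝ} {K : ℝ} (hf : IsTame f K) {u u' : ℝ → ℝ}
    (hu : IsGlobalSolution f u u') {c : ℝ} (hc : ∀ t x, f (2 * c - t) x = f t x)
    (h0 : u' c = 0) (t : ℝ) : u (2 * c - t) = u t :=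
  ((hu.comp_reflect hc).eq_of_isTame hf hu (s := c) (by ring_nf) (by ring_nf; simp [h0]) t).1

theorem exists_solution_Icc {f : ℝ → ℝ → ℝ} {K : ℝ} (hf : IsTame f K) (R : ℝ) (hR : 0 < R)
    (α : ℝ) : ∃ u u' : ℝ → ℝ, u 0 = α ∧ u' 0 = 0 ∧ ∀ t ∈ Icc (-R) R,
      HasDerivWithinAt u (u' t) (Icc (-R) R) t ∧
      HasDerivWithinAt u' (f t (u t)) (Icc (-R) R) t := by
  obtain ⟨B, hB⟩ := hf.bounded
  have hB0 : 0 ≤ B := (abs_nonneg _).trans (hB 0 0)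
  have hK := hf.nonneg
  set a : ℝ := 2 * R ^ 2 * B with ha
  have ha0 : 0 ≤ a := by positivity
  -- The system is written for `(u, S u')`. With this scaling the field has norm at most `a / R` on
  -- the ball of radius `a`, so Picard–Lindelöf covers an interval of any length; unscaled, the
  -- component `u'` would limit it.
  obtain ⟨S, hS⟩ : ∃ S, S = 2 * R := ⟨_, rfl⟩
  have hS0 : 0 < S := by rw [hS]; positivity
  obtain ⟨A, hA⟩ : ∃ A : NNReal, (A : ℝ) = a := ⟨⟨a, ha0⟩, rfl⟩
  obtain ⟨L, hL⟩ : ∃ L : NNReal, (L : ℝ) = a / R := ⟨⟨a / R, by positivity⟩, rfl⟩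
  obtain ⟨C, hC⟩ : ∃ C : NNReal, (C : ℝ) = 1 / S + S * K :=
    ⟨⟨1 / S + S * K, by positivity⟩, rfl⟩
  have hP : IsPicardLindelof (E := ℝ × ℝ) (tmin := -R) (tmax := R)
      (fun t x => (x.2 / S, S * f t x.1)) ⟨0, by simp [hR.le], hR.le⟩ (α, 0)
      A 0 L C := by
    refine ⟨fun t _ => LipschitzOnWith.of_dist_le_mul fun x _ y _ => ?_, fun x _ => ?_,
      fun t _ x hx => ?_, ?_⟩
    · have h1 := hf.lipschitz t x.1 y.1
      have h2 : |x.1 - y.1| ≤ dist x y := by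
        rw [← Real.dist_eq]; exact le_max_left _ _
      have h3 : |x.2 - y.2| ≤ dist x y := by
        rw [← Real.dist_eq]; exact le_max_right _ _
      have h4 : 0 ≤ dist x y := dist_nonneg
      rw [Prod.dist_eq]
      simp only [Real.dist_eq, hC]
      rw [← sub_div, ← mul_sub, abs_div, abs_mul, abs_of_pos hS0]
      apply max_le
      · rw [div_eq_inv_mul, ← one_div, add_mul]
        have : 0 ≤ S * K * dist x y := by positivity
        have := mul_le_mul_of_nonneg_left h3 (by positivity : 0 ≤ 1 / S)
        linarith
      · rw [add_mul]
        have : 0 ≤ 1 / S * dist x y := by positivity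
        have h5 := mul_le_mul_of_nonneg_left (h1.trans (mul_le_mul_of_nonneg_left h2 hK))
          hS0.le
        linarith
    · have := hf.continuous
      have h1 : Continuous fun t => f t x.1 := this.comp (by fun_prop : Continuous fun t => (t, x.1))
      fun_prop
    · have h1 := hB t x.1
      have h3 : |x.2| ≤ a := by
        have := (le_max_right _ _).trans (mem_closedBall_iff_norm.1 hx)
        simpa [hA] using this
      rw [Prod.norm_def]
      simp only [Real.norm_eq_abs, hL]
      rw [abs_div, abs_mul, abs_of_pos hS0]
      apply max_le
      · rw [div_le_div_iff₀ hS0 hR, hS]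
        nlinarith
      · have : a / R = S * B := by rw [ha, hS]; field_simp
        rw [this]
        gcongr
    · simp only [NNReal.coe_zero, sub_zero, zero_sub, neg_neg, max_self]
      rw [hL, hA, div_mul_cancel₀ _ hR.ne']
  obtain ⟨y, hy0, hy⟩ := hP.exists_eq_forall_mem_Icc_hasDerivWithinAt₀
  have e0 : y 0 = (α, 0) := hy0
  refine ⟨fun t => (y t).1, fun t => (y t).2 / S, by simp [e0], by simp [e0],
    fun t ht => ⟨?_, ?_⟩⟩
  · exact (hasFDerivAt_fst (p := y t)).comp_hasDerivWithinAt t (hy t ht)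
  · have := ((hasFDerivAt_snd (p := y t)).comp_hasDerivWithinAt t (hy t ht)).div_const S
    convert! this using 1
    simp only [ContinuousLinearMap.coe_snd']
    field_simp

theorem IsTame.exists_solution {f : ℝ → ℝ → ℝ} {K : ℝ} (hf : IsTame f K) (α : ℝ) :
    ∃ u u' : ℝ → ℝ, u 0 = α ∧ u' 0 = 0 ∧ IsGlobalSolution f u u' := by
  have hex := fun n : ℕ => exists_solution_Icc hf (n + 1 : ℝ) (by positivity) α
  choose U U' h0 h0' hU using hex
  have hUd : ∀ n : ℕ, ∀ t : ℝ, |t| < n + 1 → HasDerivAt (U n) (U' n t) t ∧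
      HasDerivAt (U' n) (f t (U n t)) t := by
    intro n t ht
    have ht' := abs_lt.1 ht
    have hm : Icc (-(n + 1 : ℝ)) (n + 1) ∈ 𝓝 t := Icc_mem_nhds ht'.1 ht'.2
    have := hU n t ⟨ht'.1.le, ht'.2.le⟩
    exact ⟨this.1.hasDerivAt hm, this.2.hasDerivAt hm⟩
  have hagree : ∀ n m : ℕ, ∀ t : ℝ, |t| < n + 1 → |t| < m + 1 → U n t = U m t ∧ U' n t = U' m t := by
    intro n m t hn hm
    rcases le_total 0 t with h | h
    · have hlt : ∀ x ∈ Icc 0 t, |x| ≤ |t| := fun x hx => by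
        rw [abs_of_nonneg hx.1, abs_of_nonneg h]; exact hx.2
      have := eq_of_gronwall (d := fun t => U n t - U m t) (d' := fun t => U' n t - U' m t)
        (d'' := fun t => f t (U n t) - f t (U m t)) (a := 0) (b := t) hf.nonneg
        (fun x hx => ((hUd n x ((hlt x hx).trans_lt hn)).1.sub
          (hUd m x ((hlt x hx).trans_lt hm)).1).hasDerivWithinAt)
        (fun x hx => ((hUd n x ((hlt x hx).trans_lt hn)).2.sub
          (hUd m x ((hlt x hx).trans_lt hm)).2).hasDerivWithinAt)
        (fun x _ => hf.lipschitz _ _ _) (by simp [h0]) (by simp [h0']) t ⟨h, le_rfl⟩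
      exact ⟨sub_eq_zero.1 this.1, sub_eq_zero.1 this.2⟩
    · have hlt : ∀ x ∈ Icc 0 (-t), |0 - x| ≤ |t| := fun x hx => by
        rw [zero_sub, abs_neg, abs_of_nonneg hx.1, abs_of_nonpos h]; exact hx.2
      have := eq_of_gronwall (d := fun t => U n (0 - t) - U m (0 - t))
        (d' := fun t => -U' n (0 - t) - -U' m (0 - t))
        (d'' := fun t => - -f (0 - t) (U n (0 - t)) - - -f (0 - t) (U m (0 - t)))
        (a := 0) (b := -t) hf.nonneg
        (fun x hx => ((HasDerivAt.comp_neg_left 0 (hUd n _ ((hlt x hx).trans_lt hn)).1).sub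
          (HasDerivAt.comp_neg_left 0 (hUd m _ ((hlt x hx).trans_lt hm)).1)).hasDerivWithinAt)
        (fun x hx => ((HasDerivAt.comp_neg_left 0 (hUd n _ ((hlt x hx).trans_lt hn)).2).neg.sub
          (HasDerivAt.comp_neg_left 0 (hUd m _ ((hlt x hx).trans_lt hm)).2).neg).hasDerivWithinAt)
        (fun x _ => by simpa using hf.lipschitz _ _ _) (by simp [h0]) (by simp [h0']) (-t)
        ⟨neg_nonneg.2 h, le_rfl⟩
      simp only [zero_sub, neg_neg] at this
      exact ⟨sub_eq_zero.1 this.1, by linarith [this.2]⟩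
  refine ⟨fun t => U ⌊|t|⌋₊ t, fun t => U' ⌊|t|⌋₊ t, by simp [h0], by simp [h0'], fun t => ?_⟩
  -- The index is raised by one so that a single `U N` represents the glued function on a whole
  -- neighbourhood of `t`.
  set N := ⌊|t|⌋₊ + 1 with hN
  have htN : |t| < (N : ℝ) := by rw [hN]; push_cast; exact Nat.lt_floor_add_one _
  have hev : ∀ᶠ s in 𝓝 t, |s| < (N : ℝ) :=
    (continuous_abs.tendsto t).eventually (gt_mem_nhds htN)
  have e := hUd N t (htN.trans (lt_add_one _))
  have e1 : ∀ᶠ s in 𝓝 t, U ⌊|s|⌋₊ s = U N s ∧ U' ⌊|s|⌋₊ s = U' N s := by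
    filter_upwards [hev] with s hs
    exact hagree _ _ s (Nat.lt_floor_add_one _) (hs.trans (lt_add_one _))
  have e2 := e1.self_of_nhds
  simp only
  rw [e2.1, e2.2]
  exact ⟨e.1.congr_of_eventuallyEq (e1.mono fun s hs => hs.1),
    e.2.congr_of_eventuallyEq (e1.mono fun s hs => hs.2)⟩

/-- The solutions with `u(0) = α`, `u'(0) = 0` depend continuously on `α`. -/
theorem IsTame.exists_family {f : ℝ → ℝ → ℝ} {K : ℝ} (hf : IsTame f K) :
    ∃ U U' : ℝ → ℝ → ℝ, (∀ α, U α 0 = α ∧ U' α 0 = 0 ∧ IsGlobalSolution f (U α) (U' α)) ∧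
      (∀ α β t, 0 ≤ t → |U α t - U β t| ≤ |α - β| * Real.exp ((K + 1) * t)) ∧
      ∀ t, 0 ≤ t → Continuous (fun α => U α t) ∧ Continuous (fun α => U' α t) := by
  choose U U' h0 h0' hU using hf.exists_solution
  have key : ∀ α β t, 0 ≤ t → |U α t - U β t| ≤ |α - β| * Real.exp ((K + 1) * t) ∧
      |U' α t - U' β t| ≤ |α - β| * Real.exp ((K + 1) * t) := by
    intro α β t ht
    have := abs_le_gronwall (d := fun t => U α t - U β t) (d' := fun t => U' α t - U' β t)
      (d'' := fun t => f t (U α t) - f t (U β t)) (a := 0) (b := t) (δ := |α - β|) hf.nonneg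
      (fun x _ => ((hU α x).1.sub (hU β x).1).hasDerivWithinAt)
      (fun x _ => ((hU α x).2.sub (hU β x).2).hasDerivWithinAt)
      (fun x _ => hf.lipschitz _ _ _) (by simp [h0]) (by simp [h0']) t ⟨ht, le_rfl⟩
    simpa using this
  refine ⟨U, U', fun α => ⟨h0 α, h0' α, hU α⟩, fun α β t ht => (key α β t ht).1,
    fun t ht => ?_⟩
  obtain ⟨C, hC⟩ : ∃ C : NNReal, (C : ℝ) = Real.exp ((K + 1) * t) :=
    ⟨⟨_, (Real.exp_pos _).le⟩, rfl⟩
  constructor <;> refine (LipschitzWith.of_dist_le_mul (K := C) fun α β => ?_).continuous <;>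
    rw [hC, mul_comm, Real.dist_eq, Real.dist_eq]
  exacts [(key α β t ht).1, (key α β t ht).2]

/-! ### First zeros, escape by convexity, one-sided derivative signs -/

theorem exists_first_zero {g : ℝ → ℝ} {s e : ℝ} (hg : ContinuousOn g (Icc s e)) (hse : s ≤ e)
    (hs : 0 < g s) (he : g e ≤ 0) : ∃ τ ∈ Ioc s e, g τ = 0 ∧ ∀ t ∈ Ico s τ, 0 < g t := by
  have hc : IsCompact (Icc s e ∩ g ⁻¹' Iic 0) :=
    isCompact_Icc.of_isClosed_subset (hg.preimage_isClosed_of_isClosed isClosed_Icc isClosed_Iic)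
      inter_subset_left
  obtain ⟨τ, ⟨hτ, hτ0⟩, hmin⟩ := hc.exists_isLeast ⟨e, ⟨hse, le_rfl⟩, he⟩
  have hpos : ∀ t ∈ Ico s τ, 0 < g t := fun t ht => by
    by_contra h
    exact absurd (hmin ⟨⟨ht.1, ht.2.le.trans hτ.2⟩, not_lt.1 h⟩) (not_le.2 ht.2)
  have hsτ : s < τ := lt_of_le_of_ne hτ.1 fun h => by
    rw [← h] at hτ0; exact absurd hs (not_lt.2 hτ0)
  refine ⟨τ, ⟨hsτ, hτ.2⟩, le_antisymm hτ0 ?_, hpos⟩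
  have hcw : ContinuousWithinAt g (Ico s τ) τ :=
    (hg τ hτ).mono fun t ht => ⟨ht.1, ht.2.le.trans hτ.2⟩
  have : (𝓝[Ico s τ] τ).NeBot := by
    rw [← mem_closure_iff_nhdsWithin_neBot, closure_Ico hsτ.ne]
    exact ⟨hsτ.le, le_rfl⟩
  exact ge_of_tendsto hcw (eventually_mem_nhdsWithin.mono fun t ht => (hpos t ht).le)

theorem exists_last_zero {g : ℝ → ℝ} {s e : ℝ} (hg : ContinuousOn g (Icc s e)) (hse : s ≤ e)
    (hs : g s ≤ 0) (he : 0 < g e) : ∃ τ ∈ Ico s e, g τ = 0 ∧ ∀ t ∈ Ioc τ e, 0 < g t := by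
  obtain ⟨τ, hτ, h0, hpos⟩ := exists_first_zero (g := fun t => g (-t)) (s := -e) (e := -s)
    (hg.comp continuousOn_neg fun t ht => ⟨by linarith [ht.2], by linarith [ht.1]⟩)
    (neg_le_neg hse) (by simpa using he) (by simpa using hs)
  refine ⟨-τ, ⟨by linarith [hτ.2], by linarith [hτ.1]⟩, h0, fun t ht => ?_⟩
  simpa using hpos (-t) ⟨by linarith [ht.2], by linarith [ht.1]⟩

section Convexity

variable {d d' d'' : ℝ → ℝ} (hd : ∀ t, HasDerivAt d (d' t) t) (hd' : ∀ t, HasDerivAt d' (d'' t) t)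
  {a e : ℝ} (hconv : ∀ t ∈ Icc a e, 0 < d t → 0 ≤ d'' t)

include hd hd' hconv

/-- As long as `d` is positive its slope cannot drop below `d' s ≥ 0`, so `d` does not decrease and
never gets back to zero. -/
theorem escape {s : ℝ} (has : a ≤ s) (hs : 0 < d s) (hs' : 0 ≤ d' s) :
    ∀ t ∈ Icc s e, 0 < d t ∧ d' s ≤ d' t := by
  have hcd : Continuous d := continuous_iff_continuousAt.2 fun t => (hd t).continuousAt
  have hcd' : Continuous d' := continuous_iff_continuousAt.2 fun t => (hd' t).continuousAt
  have mono : ∀ τ ∈ Icc s e, (∀ t ∈ Ico s τ, 0 < d t) → ∀ t ∈ Icc s τ, d' s ≤ d' t := by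
    intro τ hτ hp t ht
    refine monotoneOn_of_hasDerivWithinAt_nonneg (convex_Icc s τ) hcd'.continuousOn
      (f' := d'') (fun x _ => (hd' x).hasDerivWithinAt) (fun x hx => ?_) ⟨le_rfl, hτ.1⟩ ht ht.1
    rw [interior_Icc] at hx
    exact hconv x ⟨has.trans hx.1.le, hx.2.le.trans hτ.2⟩ (hp x ⟨hx.1.le, hx.2⟩)
  have pos : ∀ t ∈ Icc s e, 0 < d t := by
    intro t ht
    by_contra hneg
    obtain ⟨τ, hτ, h0, hp⟩ := exists_first_zero hcd.continuousOn ht.1 hs (not_lt.1 hneg)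
    have hm := mono τ ⟨hτ.1.le, hτ.2.trans ht.2⟩ hp
    have := monotoneOn_of_hasDerivWithinAt_nonneg (convex_Icc s τ) hcd.continuousOn
      (f' := d') (fun x _ => (hd x).hasDerivWithinAt)
      (fun x hx => hs'.trans (hm x (interior_subset hx))) ⟨le_rfl, hτ.1.le⟩ ⟨hτ.1.le, le_rfl⟩ hτ.1.le
    linarith
  exact fun t ht => ⟨pos t ht,
    mono t ht (fun x hx => pos x ⟨hx.1, hx.2.le.trans ht.2⟩) t ⟨ht.1, le_rfl⟩⟩

/-- After the last zero of `d` before `s`, the mean value theorem finds a positive slope; `escape`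
carries it to the end. The strict sign of `d' e` is what rules out a Neumann condition there. -/
theorem escape_of_nonpos (ha : d a ≤ 0) {s : ℝ} (hs : s ∈ Icc a e) (hds : 0 < d s) :
    0 < d e ∧ 0 < d' e := by
  have hcd : Continuous d := continuous_iff_continuousAt.2 fun t => (hd t).continuousAt
  obtain ⟨τ, hτ, h0, hp⟩ := exists_last_zero hcd.continuousOn hs.1 ha hds
  obtain ⟨c, hc, hc'⟩ := exists_hasDerivAt_eq_slope d d' hτ.2 hcd.continuousOn fun x _ => hd x
  have hc0 : 0 < d' c := by
    rw [hc', h0, sub_zero]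
    exact div_pos hds (sub_pos.2 hτ.2)
  have := escape hd hd' hconv (hτ.1.trans hc.1.le) (hp c ⟨hc.1, hc.2.le⟩) hc0.le e
    ⟨hc.2.le.trans hs.2, le_rfl⟩
  exact ⟨this.1, hc0.trans_le this.2⟩

theorem escape_of_deriv_nonneg (ha : 0 ≤ d' a) {s : ℝ} (hs : s ∈ Icc a e) (hds : 0 < d s) :
    0 < d e := by
  rcases le_or_gt (d a) 0 with h | h
  · exact (escape_of_nonpos hd hd' hconv h hs hds).1
  · exact (escape hd hd' hconv le_rfl h ha e ⟨hs.1.trans hs.2, le_rfl⟩).1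

end Convexity

/-- Second derivative test to the right of a critical point; it excludes degenerate touching. -/
theorem exists_gt_of_deriv2_pos {d d' : ℝ → ℝ} {s c : ℝ} (hd : ∀ t, HasDerivAt d (d' t) t)
    (hc : HasDerivAt d' c s) (h0 : d' s = 0) (hpos : 0 < c) {e : ℝ} (he : s < e) :
    ∃ t ∈ Ioo s e, d s < d t := by
  have h1 : ∀ᶠ t in 𝓝[>] s, 0 < d' t := by
    have := (hasDerivAt_iff_tendsto_slope.1 hc).mono_left
      (nhdsWithin_mono s (fun t (ht : s < t) => ht.ne' : Ioi s ⊆ {s}ᶜ))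
    filter_upwards [this.eventually (lt_mem_nhds hpos), self_mem_nhdsWithin] with t ht hst
    rw [slope_def_field, h0, sub_zero] at ht
    exact (div_pos_iff_of_pos_right (sub_pos.2 hst)).1 ht
  obtain ⟨r, hr, hr'⟩ := (mem_nhdsGT_iff_exists_Ioo_subset.1 h1)
  set t := (s + min r e) / 2 with ht
  have hm : s < min r e := lt_min hr he
  have hst : s < t := by linarith
  have htm : t < min r e := by linarith
  obtain ⟨x, hx, hx'⟩ := exists_hasDerivAt_eq_slope d d' hst
    (continuous_iff_continuousAt.2 fun t => (hd t).continuousAt).continuousOn fun x _ => hd x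
  have : 0 < d' x := hr' ⟨hx.1, (hx.2.trans htm).trans_le (min_le_left _ _)⟩
  rw [hx', div_pos_iff_of_pos_right (sub_pos.2 hst)] at this
  exact ⟨t, ⟨hst, htm.trans_le (min_le_right _ _)⟩, sub_pos.1 this⟩

theorem deriv_nonpos_of_pos_left {g : ℝ → ℝ} {g' s b : ℝ}
    (h : HasDerivWithinAt g g' (Icc s b) b) (hsb : s < b) (hb : g b = 0)
    (hp : ∀ t ∈ Ioo s b, 0 < g t) : g' ≤ 0 := by
  have h1 := hasDerivWithinAt_iff_tendsto_slope.1 (h.mono Ioo_subset_Icc_self)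
  rw [sdiff_singleton_eq_self (fun h => lt_irrefl _ h.2)] at h1
  have : (𝓝[Ioo s b] b).NeBot := by
    rw [← mem_closure_iff_nhdsWithin_neBot, closure_Ioo hsb.ne]
    exact ⟨hsb.le, le_rfl⟩
  refine le_of_tendsto h1 (eventually_mem_nhdsWithin.mono fun t ht => ?_)
  rw [slope_def_field, hb, sub_zero]
  exact div_nonpos_of_nonneg_of_nonpos (hp t ht).le (sub_nonpos.2 ht.2.le)

theorem deriv_nonneg_of_pos_right {g : ℝ → ℝ} {g' a s : ℝ}
    (h : HasDerivWithinAt g g' (Icc a s) a) (has : a < s) (ha : g a = 0)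
    (hp : ∀ t ∈ Ioo a s, 0 < g t) : 0 ≤ g' := by
  have h1 := hasDerivWithinAt_iff_tendsto_slope.1 (h.mono Ioo_subset_Icc_self)
  rw [sdiff_singleton_eq_self (fun h => lt_irrefl _ h.1)] at h1
  have : (𝓝[Ioo a s] a).NeBot := by
    rw [← mem_closure_iff_nhdsWithin_neBot, closure_Ioo has.ne]
    exact ⟨le_rfl, has.le⟩
  refine ge_of_tendsto h1 (eventually_mem_nhdsWithin.mono fun t ht => ?_)
  rw [slope_def_field, ha, sub_zero]
  exact div_nonneg (hp t ht).le (sub_nonneg.2 ht.1.le)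

/-! ### Comparison and monotonicity of negative solutions -/

/-- The right-hand side of the forced Duffing equation. -/
noncomputable def force (ε lam t x : ℝ) : ℝ := (x ^ 3 - lam * x + Real.cos t) / ε ^ 2

/-- Comparison of negative solutions through the Wronskian `u' v - u v'`. -/
theorem le_of_negative_solutions {ε lam c : ℝ} (hε : 0 < ε) (hcπ : c ≤ Real.pi / 2)
    {u u' v v' : ℝ → ℝ} (hu : IsSolutionOn ε lam (Icc 0 c) u u')
    (hv : IsSolutionOn ε lam (Icc 0 c) v v') (hu0 : u' 0 = 0) (hv0 : v' 0 = 0)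
    (hun : ∀ t ∈ Ico 0 c, u t < 0) (hvn : ∀ t ∈ Ico 0 c, v t < 0) (huc : u c ≤ 0)
    (hvc : v c ≤ u c) : ∀ t ∈ Icc 0 c, v t ≤ u t := by
  intro s hs
  by_contra! hlt
  have hg : ContinuousOn (fun t => v t - u t) (Icc 0 c) := fun t ht =>
    (hv t ht).1.continuousWithinAt.sub (hu t ht).1.continuousWithinAt
  obtain ⟨b, hb, hb0, hbp⟩ := exists_first_zero (g := fun t => v t - u t)
    (hg.mono (Icc_subset_Icc_left hs.1)) hs.2 (sub_pos.2 hlt) (sub_nonpos.2 hvc)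
  have hbm : b ∈ Icc 0 c := ⟨hs.1.trans hb.1.le, hb.2⟩
  have hub : u b ≤ 0 := by
    rcases hb.2.lt_or_eq with h | h
    · exact (hun b ⟨hbm.1, h⟩).le
    · rwa [h]
  -- The interval where `v > u` starts either at a crossing, where `u < 0` and `v' ≥ u'`, or at `0`,
  -- where both slopes vanish. Either way the Wronskian starts nonnegative; it ends nonpositive at
  -- `b`, yet increases strictly in between because `u < v < 0` and `cos t > 0`.
  obtain ⟨a, ha, hap, hWa⟩ : ∃ a ∈ Icc 0 s, (∀ t ∈ Ioc a s, 0 < v t - u t) ∧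
      0 ≤ u' a * v a - u a * v' a := by
    by_cases hex : ∃ t ∈ Icc 0 s, v t - u t ≤ 0
    · obtain ⟨t, ht, ht0⟩ := hex
      obtain ⟨a, ha, ha0, hap⟩ := exists_last_zero (g := fun t => v t - u t)
        (hg.mono (Icc_subset_Icc ht.1 hs.2)) ht.2 ht0 (sub_pos.2 hlt)
      have ham : a ∈ Icc 0 c := ⟨ht.1.trans ha.1, ha.2.le.trans hs.2⟩
      refine ⟨a, ⟨ham.1, ha.2.le⟩, hap, ?_⟩
      have := deriv_nonneg_of_pos_right (g := fun t => v t - u t)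
        (((hv a ham).1.sub (hu a ham).1).mono (Icc_subset_Icc ham.1 hs.2)) ha.2 ha0
        (fun t ht => hap t ⟨ht.1, ht.2.le⟩)
      have e : v a = u a := sub_eq_zero.1 ha0
      have := hun a ⟨ham.1, ha.2.trans_le hs.2⟩
      rw [e]
      nlinarith
    · push Not at hex
      exact ⟨0, ⟨le_rfl, hs.1⟩, fun t ht => hex t ⟨ht.1.le, ht.2⟩, by simp [hu0, hv0]⟩
  have hWb : u' b * v b - u b * v' b ≤ 0 := by
    have := deriv_nonpos_of_pos_left (g := fun t => v t - u t)
      (((hv b hbm).1.sub (hu b hbm).1).mono (Icc_subset_Icc hs.1 hb.2)) hb.1 hb0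
      (fun t ht => hbp t ⟨ht.1.le, ht.2⟩)
    have e : v b = u b := sub_eq_zero.1 hb0
    rw [e]
    nlinarith
  have hsub : Icc a b ⊆ Icc 0 c := Icc_subset_Icc ha.1 hb.2
  have hab : a < b := ha.2.trans_lt hb.1
  have hW : ∀ t ∈ Icc a b, HasDerivWithinAt (fun t => u' t * v t - u t * v' t)
      ((u t * v t * (u t ^ 2 - v t ^ 2) + Real.cos t * (v t - u t)) / ε ^ 2) (Icc a b) t := by
    intro t ht
    have h1 := hu t (hsub ht)
    have h2 := hv t (hsub ht)
    convert! ((h1.2.mul h2.1).sub (h1.1.mul h2.2)).mono hsub using 1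
    field_simp
    ring
  have hmono : StrictMonoOn (fun t => u' t * v t - u t * v' t) (Icc a b) := by
    refine strictMonoOn_of_hasDerivWithinAt_pos (convex_Icc a b)
      (fun t ht => (hW t ht).continuousWithinAt)
      (fun t ht => (hW t (interior_subset ht)).mono interior_subset) fun t ht => ?_
    rw [interior_Icc] at ht
    have hd : 0 < v t - u t := by
      rcases le_or_gt t s with h | h
      · exact hap t ⟨ht.1, h⟩
      · exact hbp t ⟨h.le, ht.2⟩
    have ht0 : t ∈ Ico 0 c := ⟨ha.1.trans ht.1.le, ht.2.trans_le hb.2⟩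
    have h1 := hun t ht0
    have h2 := hvn t ht0
    have h3 : 0 < Real.cos t := Real.cos_pos_of_mem_Ioo
      ⟨by linarith [Real.pi_pos, ht0.1], by linarith [ht0.2]⟩
    have h4 : 0 < u t ^ 2 - v t ^ 2 := by nlinarith
    have h5 := mul_pos_of_neg_of_neg h1 h2
    positivity
  have := hmono ⟨le_rfl, hab.le⟩ ⟨hab.le, le_rfl⟩ hab
  simp only at this
  linarith

theorem hasDerivAt_force {ε lam t : ℝ} (hε : 0 < ε) {u : ℝ → ℝ} {m : ℝ} (hu : HasDerivAt u m t) :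
    HasDerivAt (fun t => force ε lam t (u t))
      (((3 * u t ^ 2 - lam) * m - Real.sin t) / ε ^ 2) t := by
  unfold force
  convert! (((hu.pow 3).sub (hu.const_mul lam)).add (Real.hasDerivAt_cos t)).div_const (ε ^ 2)
    using 1
  field_simp
  ring

/-- A solution that is negative before its zero `π/2` and has `u'(0) = 0` increases there. -/
theorem deriv_pos_of_negative {ε lam : ℝ} (hε : 0 < ε) {u u' : ℝ → ℝ}
    (hu : IsGlobalSolution (force ε lam) u u') (h0 : u' 0 = 0)
    (hneg : ∀ t ∈ Ico 0 (Real.pi / 2), u t < 0) (hpi : u (Real.pi / 2) = 0) :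
    ∀ t ∈ Ioo 0 (Real.pi / 2), 0 < u' t := by
  have hcu : Continuous u := continuous_iff_continuousAt.2 fun t => (hu t).1.continuousAt
  have hcu' : Continuous u' := continuous_iff_continuousAt.2 fun t => (hu t).2.continuousAt
  have hnn : ∀ t ∈ Ioo 0 (Real.pi / 2), 0 ≤ u' t := by
    intro s hs
    by_contra! hlt
    -- If `u` decreases at `s`, take the critical point `a` where the descent begins and the first
    -- later return `b` to the level `u a`.
    obtain ⟨a, ha, ha0, hap⟩ := exists_last_zero (g := fun t => -u' t) (s := 0)
      hcu'.neg.continuousOn hs.1.le (by simp [h0]) (neg_pos.2 hlt)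
    have ha0 : u' a = 0 := neg_eq_zero.1 ha0
    have hanti : StrictAntiOn u (Icc a s) := by
      refine strictAntiOn_of_hasDerivWithinAt_neg (convex_Icc a s) hcu.continuousOn
        (fun t _ => (hu t).1.hasDerivWithinAt) fun t ht => ?_
      rw [interior_Icc] at ht
      exact neg_pos.1 (hap t ⟨ht.1, ht.2.le⟩)
    have hus := hanti ⟨le_rfl, ha.2.le⟩ ⟨ha.2.le, le_rfl⟩ ha.2
    obtain ⟨b, hb, hb0, hbp⟩ := exists_first_zero (g := fun t => u a - u t) (s := s)
      (e := Real.pi / 2) (by fun_prop) hs.2.le (sub_pos.2 hus)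
      (by rw [hpi, sub_zero]; exact (hneg a ⟨ha.1, ha.2.trans hs.2⟩).le)
    have hb0 : u b = u a := (sub_eq_zero.1 hb0).symm
    have hab : a < b := ha.2.trans hb.1
    -- An energy with the forcing term measured from the level `u a`: it strictly decreases while `u
    -- < u a`, but equal levels and `u' a = 0` make its value at `b` at least that at `a`.
    have hE : ∀ t, HasDerivAt (fun t => ε ^ 2 * u' t ^ 2 / 2 -
        (u t ^ 4 / 4 - lam * u t ^ 2 / 2 + (u t - u a) * Real.cos t))
        ((u t - u a) * Real.sin t) t := by
      intro t
      obtain ⟨h1, h2⟩ := hu t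
      convert! (((h2.pow 2).const_mul (ε ^ 2)).div_const 2).sub
        ((((h1.pow 4).div_const 4).sub (((h1.pow 2).const_mul lam).div_const 2)).add
          ((h1.sub_const (u a)).mul (Real.hasDerivAt_cos t))) using 1
      unfold force
      field_simp
      ring
    have hanti' := strictAntiOn_of_hasDerivWithinAt_neg (convex_Icc a b)
      (fun t _ => (hE t).continuousAt.continuousWithinAt)
      (fun t _ => (hE t).hasDerivWithinAt) fun t ht => by
        rw [interior_Icc] at ht
        refine mul_neg_of_neg_of_pos ?_ (Real.sin_pos_of_pos_of_lt_pi (ha.1.trans_lt ht.1)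
          (by linarith [ht.2, hb.2, Real.pi_pos]))
        rcases le_or_gt t s with h | h
        · exact sub_neg.2 (hanti ⟨le_rfl, ha.2.le⟩ ⟨ht.1.le, h⟩ ht.1)
        · linarith [hbp t ⟨h.le, ht.2⟩]
    have := hanti' ⟨le_rfl, hab.le⟩ ⟨hab.le, le_rfl⟩ hab
    simp only [hb0, ha0] at this
    have : 0 ≤ ε ^ 2 * u' b ^ 2 / 2 := by positivity
    linarith
  intro s hs
  refine (hnn s hs).lt_of_ne fun h => ?_
  -- A zero of `u'` would be a minimum of `u'`, so `u'' = 0`; then `u''' = -sin s / ε² < 0` makes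
  -- `u'` negative just afterwards.
  have hmin : IsLocalMin u' s := by
    filter_upwards [Ioo_mem_nhds hs.1 hs.2] with t ht
    rw [← h]
    exact hnn t ht
  have hz := hmin.hasDerivAt_eq_zero (hu s).2
  have hsin := Real.sin_pos_of_pos_of_lt_pi hs.1 (by linarith [hs.2, Real.pi_pos])
  obtain ⟨t, ht, hlt⟩ := exists_gt_of_deriv2_pos (d := fun t => -u' t)
    (d' := fun t => -force ε lam t (u t)) (c := Real.sin s / ε ^ 2) (fun t => (hu t).2.neg)
    (by
      have := (hasDerivAt_force (lam := lam) hε (hu s).1).neg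
      rw [← h] at this
      convert! this using 1
      ring)
    (by simp [hz]) (by positivity) hs.2
  linarith [hnn t ⟨hs.1.trans ht.1, ht.2⟩]

/-! ### Frozen forces and symmetric functions -/

/-- The force, frozen outside the strip between `lo` and `hi`. -/
noncomputable def clampForce (ε lam : ℝ) (lo hi : ℝ → ℝ) (t x : ℝ) : ℝ :=
  force ε lam t (max (lo t) (min x (hi t)))

theorem clampForce_of_mem {ε lam : ℝ} {lo hi : ℝ → ℝ} {t x : ℝ} (h : lo t ≤ x) (h' : x ≤ hi t) :
    clampForce ε lam lo hi t x = force ε lam t x := by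
  rw [clampForce, min_eq_left h', max_eq_right h]

theorem clampForce_of_le {ε lam : ℝ} {lo hi : ℝ → ℝ} {t x : ℝ} (h : x ≤ lo t) :
    clampForce ε lam lo hi t x = force ε lam t (lo t) := by
  rw [clampForce, max_eq_left ((min_le_left _ _).trans h)]

theorem clampForce_of_ge {ε lam : ℝ} {lo hi : ℝ → ℝ} {t x : ℝ} (h : lo t ≤ hi t) (h' : hi t ≤ x) :
    clampForce ε lam lo hi t x = force ε lam t (hi t) := by
  rw [clampForce, min_eq_right h', max_eq_right h]

theorem abs_force_sub_le {ε lam M t x y : ℝ} (hε : 0 < ε) (hx : |x| ≤ M) (hy : |y| ≤ M) :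
    |force ε lam t x - force ε lam t y| ≤ (3 * M ^ 2 + |lam|) / ε ^ 2 * |x - y| := by
  have e : force ε lam t x - force ε lam t y =
      (x ^ 2 + x * y + y ^ 2 - lam) / ε ^ 2 * (x - y) := by
    unfold force; field_simp; ring
  rw [e, abs_mul, abs_div, abs_of_pos (by positivity : 0 < ε ^ 2)]
  gcongr
  have hM := (abs_nonneg x).trans hx
  have h1 : |x| * |x| ≤ M * M := mul_le_mul hx hx (abs_nonneg _) hM
  have h2 : |x| * |y| ≤ M * M := mul_le_mul hx hy (abs_nonneg _) hM
  have h3 : |y| * |y| ≤ M * M := mul_le_mul hy hy (abs_nonneg _) hM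
  rw [← abs_mul] at h1 h2 h3
  calc |x ^ 2 + x * y + y ^ 2 - lam| ≤ |x * x| + |x * y| + |y * y| + |lam| := by
        have h4 := abs_sub (x * x + x * y + y * y) lam
        have h5 := abs_add_three (x * x) (x * y) (y * y)
        rw [show x ^ 2 + x * y + y ^ 2 = x * x + x * y + y * y by ring]
        linarith
    _ ≤ _ := by linarith

theorem isTame_clampForce {ε lam M : ℝ} (hε : 0 < ε) {lo hi : ℝ → ℝ} (hlo : Continuous lo)
    (hhi : Continuous hi) (hloM : ∀ t, |lo t| ≤ M) (hhiM : ∀ t, |hi t| ≤ M) :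
    IsTame (clampForce ε lam lo hi) ((3 * M ^ 2 + |lam|) / ε ^ 2) := by
  have hcl : ∀ t x, |max (lo t) (min x (hi t))| ≤ M := fun t x => by
    rw [abs_le]
    have h1 := abs_le.1 (hloM t)
    have h2 := abs_le.1 (hhiM t)
    exact ⟨h1.1.trans (le_max_left _ _), max_le h1.2 ((min_le_right _ _).trans h2.2)⟩
  refine ⟨?_, by positivity, fun t x y => ?_, ⟨(M ^ 3 + |lam| * M + 1) / ε ^ 2, fun t x => ?_⟩⟩
  · unfold clampForce force Function.uncurry
    fun_prop
  · refine (abs_force_sub_le hε (hcl t x) (hcl t y)).trans ?_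
    refine mul_le_mul_of_nonneg_left ?_ (by positivity)
    refine (abs_max_sub_max_le_max (lo t) (min x (hi t)) (lo t) (min y (hi t))).trans ?_
    rw [sub_self, abs_zero]
    refine max_le (abs_nonneg _) ((abs_min_sub_min_le_max x (hi t) y (hi t)).trans ?_)
    simp
  · unfold clampForce force
    rw [abs_div, abs_of_pos (by positivity : 0 < ε ^ 2)]
    gcongr
    set y := max (lo t) (min x (hi t)) with hy
    have hyM := hcl t x
    calc |y ^ 3 - lam * y + Real.cos t| ≤ |y| ^ 3 + |lam| * |y| + |Real.cos t| := by
          rw [← abs_pow, ← abs_mul, sub_eq_add_neg, ← abs_neg (lam * y)]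
          exact abs_add_three _ _ _
      _ ≤ _ := by gcongr; exact Real.abs_cos_le_one t

/-- Even functions with the further symmetry axis `π`. -/
structure IsSym (u : ℝ → ℝ) : Prop where
  neg : ∀ t, u (-t) = u t
  reflect : ∀ t, u (2 * Real.pi - t) = u t

theorem IsSym.periodic {u : ℝ → ℝ} (h : IsSym u) : Function.Periodic u (2 * Real.pi) := by
  intro t
  rw [← h.reflect, ← h.neg t]
  congr 1
  ring

/-- Periodicity and reflection fold the line onto `[0, π]`. The point `s` is chosen before `u`, so
several functions can be moved at once and compared there. -/
theorem exists_mem_Icc_isSym (t : ℝ) : ∃ s ∈ Icc 0 Real.pi, ∀ u, IsSym u → u t = u s := by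
  have hp : 0 < 2 * Real.pi := by positivity
  have hm := toIcoMod_mem_Ico hp 0 t
  have he : ∀ u, IsSym u → u (toIcoMod hp 0 t) = u t := fun u hu => by
    rw [toIcoMod]
    exact hu.periodic.sub_zsmul_eq _
  rw [zero_add] at hm
  rcases le_or_gt (toIcoMod hp 0 t) Real.pi with h | h
  · exact ⟨_, ⟨hm.1, h⟩, fun u hu => (he u hu).symm⟩
  · refine ⟨2 * Real.pi - toIcoMod hp 0 t, ⟨by linarith [hm.2], by linarith⟩, fun u hu => ?_⟩
    rw [hu.reflect, he u hu]

theorem IsGlobalSolution.continuous {f : ℝ → ℝ → ℝ} {u u' : ℝ → ℝ} (h : IsGlobalSolution f u u') :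
    Continuous u := continuous_iff_continuousAt.2 fun t => (h t).1.continuousAt

theorem IsGlobalSolution.of_clampForce {ε lam : ℝ} {lo hi u u' : ℝ → ℝ}
    (h : IsGlobalSolution (clampForce ε lam lo hi) u u') (hlo : ∀ t, lo t ≤ u t)
    (hhi : ∀ t, u t ≤ hi t) : IsGlobalSolution (force ε lam) u u' := fun t =>
  ⟨(h t).1, by rw [← clampForce_of_mem (hlo t) (hhi t)]; exact (h t).2⟩

theorem IsGlobalSolution.isSym {ε lam K : ℝ} {lo hi u u' : ℝ → ℝ}
    (hf : IsTame (clampForce ε lam lo hi) K)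
    (hlo : IsSym lo) (hhi : IsSym hi) (h : IsGlobalSolution (clampForce ε lam lo hi) u u')
    (h0 : u' 0 = 0) (hpi : u' Real.pi = 0) : IsSym u where
  neg t := by
    have := h.reflect_eq hf (c := 0) (fun t x => by
      simp [clampForce, force, hlo.neg, hhi.neg]) h0 t
    simpa using this
  reflect t := h.reflect_eq hf (c := Real.pi) (fun t x => by
      simp [clampForce, force, hlo.reflect, hhi.reflect]) hpi t

theorem isSym_const (c : ℝ) : IsSym fun _ => c := ⟨fun _ => rfl, fun _ => rfl⟩

/-! ### Barriers, the upper solution and the middle solution -/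

/-- `m` and `b` are strict constant barriers, and the force increases above `m`. -/
structure Barriers (lam m b : ℝ) : Prop where
  pos : 0 < m
  lt : m < b
  deriv_pos : lam < 3 * m ^ 2
  lower : m ^ 3 - lam * m < -1
  upper : 1 < b ^ 3 - lam * b

theorem exists_barriers {lam b : ℝ} (hlam : (3 : ℝ) / (2 : ℝ) ^ ((2 : ℝ) / 3) < lam)
    (hb : 0 < b) (hb' : 0 < b ^ 3 - lam * b - 1) : ∃ m, Barriers lam m b := by
  have hl0 : 0 < lam := lt_trans (by positivity) hlam
  have h4 : ((2 : ℝ) ^ ((2 : ℝ) / 3)) ^ 3 = 4 := by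
    rw [← Real.rpow_natCast, ← Real.rpow_mul (by norm_num)]
    norm_num
  have hl3 : 27 / 4 < lam ^ 3 := by
    have := pow_lt_pow_left₀ hlam (by positivity) (n := 3) (by norm_num)
    rw [div_pow, h4] at this
    linarith
  set r := Real.sqrt (lam / 3) with hr
  have hr0 : 0 < r := Real.sqrt_pos.2 (by positivity)
  have hr2 : r ^ 2 = lam / 3 := Real.sq_sqrt (by positivity)
  -- The local minimum of `x³ - lam x` is `-2 r³`, and the bound on `lam` says exactly that this is
  -- below `-1`. Any `m` slightly larger than `r` then keeps the inequality and adds `lam < 3 m²`.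
  have hr3 : 1 / 2 < r ^ 3 := by
    by_contra! h
    have h6 : (r ^ 3) ^ 2 ≤ (1 / 2) ^ 2 := pow_le_pow_left₀ (by positivity) h 2
    have : (r ^ 3) ^ 2 = lam ^ 3 / 27 := by
      rw [← pow_mul, mul_comm, pow_mul, hr2]; ring
    linarith
  have hlow : r ^ 3 - lam * r < -1 := by
    have : lam = 3 * r ^ 2 := by linarith
    rw [this]
    nlinarith
  have hev : ∀ᶠ x in 𝓝[>] r, x ^ 3 - lam * x < -1 :=
    ((by fun_prop : Continuous fun x : ℝ => x ^ 3 - lam * x).tendsto r).mono_left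
      nhdsWithin_le_nhds |>.eventually (gt_mem_nhds hlow)
  obtain ⟨m, hm, hrm⟩ := (hev.and self_mem_nhdsWithin).exists
  have hrm : r < m := hrm
  have hm0 : 0 < m := hr0.trans hrm
  refine ⟨m, hm0, ?_, by nlinarith, hm, by linarith⟩
  by_contra! h
  have h1 : lam < b ^ 2 := by
    by_contra! h
    nlinarith
  have h2 : b ^ 2 ≤ m ^ 2 := by gcongr
  nlinarith

section

variable {ε lam m b : ℝ}

/-- Above `b` the frozen force is positive and below `m` negative, whatever `t`, so a shot that ever
leaves the strip reaches `π` with slope of a definite sign. A zero slope at `π` therefore confines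
the solution. -/
theorem exists_upper (hε : 0 < ε) (hB : Barriers lam m b) :
    ∃ u u' : ℝ → ℝ, IsGlobalSolution (force ε lam) u u' ∧ u' 0 = 0 ∧ u' Real.pi = 0 ∧ IsSym u ∧
      ∀ t, m ≤ u t ∧ u t ≤ b := by
  have hb0 : 0 < b := hB.pos.trans hB.lt
  have hf := isTame_clampForce (lam := lam) hε (continuous_const (y := m))
    (continuous_const (y := b)) (M := b) (fun _ => by rw [abs_of_pos hB.pos]; exact hB.lt.le)
    (fun _ => by rw [abs_of_pos hb0])
  obtain ⟨U, U', hU, -, hcont⟩ := hf.exists_family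
  have hpi := Real.pi_pos
  have hup : ∀ t x, b ≤ x → 0 < clampForce ε lam (fun _ => m) (fun _ => b) t x := by
    intro t x hx
    rw [clampForce_of_ge hB.lt.le hx]
    exact div_pos (by linarith [Real.neg_one_le_cos t, hB.upper]) (by positivity)
  have hlow : ∀ t x, x ≤ m → clampForce ε lam (fun _ => m) (fun _ => b) t x < 0 := by
    intro t x hx
    rw [clampForce_of_le hx]
    exact div_neg_of_neg_of_pos (by linarith [Real.cos_le_one t, hB.lower]) (by positivity)
  have above : ∀ α, ∀ s ∈ Icc 0 Real.pi, b < U α s → 0 < U' α Real.pi := by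
    intro α s hs hbs
    obtain ⟨h0, h0', hsol⟩ := hU α
    have hd : ∀ t, HasDerivAt (fun t => U α t - b) (U' α t) t := fun t => (hsol t).1.sub_const b
    have hconv : ∀ t ∈ Icc 0 Real.pi, 0 < U α t - b →
        0 ≤ clampForce ε lam (fun _ => m) (fun _ => b) t (U α t) :=
      fun t _ ht => (hup t _ (sub_pos.1 ht).le).le
    rcases le_or_gt (U α 0 - b) 0 with h | h
    · exact (escape_of_nonpos hd (fun t => (hsol t).2) hconv h hs (sub_pos.2 hbs)).2
    · have hpos := escape hd (fun t => (hsol t).2) hconv le_rfl h h0'.ge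
      have := strictMonoOn_of_hasDerivWithinAt_pos (convex_Icc 0 Real.pi)
        (fun t _ => (hsol t).2.continuousAt.continuousWithinAt)
        (fun t _ => (hsol t).2.hasDerivWithinAt)
        (fun t ht => hup t _ (sub_pos.1 (hpos t (interior_subset ht)).1).le)
        ⟨le_rfl, hpi.le⟩ ⟨hpi.le, le_rfl⟩ hpi
      linarith
  have below : ∀ α, ∀ s ∈ Icc 0 Real.pi, U α s < m → U' α Real.pi < 0 := by
    intro α s hs hbs
    obtain ⟨h0, h0', hsol⟩ := hU α
    have hd : ∀ t, HasDerivAt (fun t => m - U α t) (-U' α t) t := fun t => (hsol t).1.const_sub m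
    have hd' : ∀ t, HasDerivAt (fun t => -U' α t)
      (-clampForce ε lam (fun _ => m) (fun _ => b) t (U α t)) t := fun t => (hsol t).2.neg
    have hconv : ∀ t ∈ Icc 0 Real.pi, 0 < m - U α t →
        0 ≤ -clampForce ε lam (fun _ => m) (fun _ => b) t (U α t) :=
      fun t _ ht => neg_nonneg.2 (hlow t _ (sub_pos.1 ht).le).le
    rcases le_or_gt (m - U α 0) 0 with h | h
    · exact neg_pos.1 (escape_of_nonpos hd hd' hconv h hs (sub_pos.2 hbs)).2
    · have hpos := escape hd hd' hconv le_rfl h (by simp [h0'])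
      have := strictMonoOn_of_hasDerivWithinAt_pos (convex_Icc 0 Real.pi)
        (fun t _ => (hd' t).continuousAt.continuousWithinAt)
        (fun t _ => (hd' t).hasDerivWithinAt)
        (fun t ht => neg_pos.2 (hlow t _ (sub_pos.1 (hpos t (interior_subset ht)).1).le))
        ⟨le_rfl, hpi.le⟩ ⟨hpi.le, le_rfl⟩ hpi
      simp only at this
      linarith
  have hz : (0 : ℝ) ∈ Icc 0 Real.pi := ⟨le_rfl, hpi.le⟩
  obtain ⟨α, -, hα⟩ := intermediate_value_Icc (a := m - 1) (b := b + 1) (by linarith [hB.lt])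
    (hcont Real.pi hpi.le).2.continuousOn
    (show (0 : ℝ) ∈ _ from ⟨(below (m - 1) 0 hz (by rw [(hU _).1]; linarith)).le,
      (above (b + 1) 0 hz (by rw [(hU _).1]; linarith)).le⟩)
  simp only at hα
  obtain ⟨-, h0', hsol⟩ := hU α
  have hsym := hsol.isSym hf (isSym_const m) (isSym_const b) h0' hα
  have hbd : ∀ t, m ≤ U α t ∧ U α t ≤ b := by
    intro t
    obtain ⟨s, hs, hts⟩ := exists_mem_Icc_isSym t
    rw [hts _ hsym]
    constructor <;> by_contra! h
    · exact (below α s hs h).ne hα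
    · exact (above α s hs h).ne' hα
  exact ⟨U α, U' α, hsol.of_clampForce (fun t => (hbd t).1) (fun t => (hbd t).2), h0', hα, hsym, hbd⟩

/-- The middle solution, first on a quarter period. -/
theorem exists_middle_quarter (hε : 0 < ε) (hB : Barriers lam m b) :
    ∃ u u' : ℝ → ℝ, IsGlobalSolution (clampForce ε lam (fun _ => -b) fun _ => 0) u u' ∧
      u' 0 = 0 ∧ u (Real.pi / 2) = 0 ∧ ∀ t ∈ Icc 0 (Real.pi / 2), -b ≤ u t ∧ u t ≤ 0 := by
  have hb0 : 0 < b := hB.pos.trans hB.lt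
  have hf := isTame_clampForce (lam := lam) hε (continuous_const (y := -b))
    (continuous_const (y := 0)) (M := b) (fun _ => by rw [abs_neg, abs_of_pos hb0])
    (fun _ => by rw [abs_zero]; exact hb0.le)
  obtain ⟨U, U', hU, -, hcont⟩ := hf.exists_family
  have hpi : 0 < Real.pi / 2 := by positivity
  have above : ∀ α, ∀ s ∈ Icc 0 (Real.pi / 2), 0 < U α s → 0 < U α (Real.pi / 2) := by
    intro α s hs hbs
    obtain ⟨h0, h0', hsol⟩ := hU α
    refine escape_of_deriv_nonneg (fun t => (hsol t).1) (fun t => (hsol t).2)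
      (fun t ht h => ?_) h0'.ge hs hbs
    -- Frozen at `0` the force is `cos t / ε²`, which points outward only up to `π/2`; hence the
    -- restriction to a quarter period.
    rw [clampForce_of_ge (neg_nonpos.2 hb0.le) h.le]
    have := Real.cos_nonneg_of_mem_Icc ⟨by linarith [ht.1], ht.2⟩
    exact div_nonneg (by simpa using this) (by positivity)
  have below : ∀ α, ∀ s ∈ Icc 0 (Real.pi / 2), U α s < -b → U α (Real.pi / 2) < -b := by
    intro α s hs hbs
    obtain ⟨h0, h0', hsol⟩ := hU α
    refine sub_pos.1 (escape_of_deriv_nonneg (d := fun t => -b - U α t)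
      (fun t => (hsol t).1.const_sub _) (fun t => (hsol t).2.neg)
      (fun t ht h => ?_) (by simp [h0']) hs (sub_pos.2 hbs))
    rw [clampForce_of_le (lo := fun _ => -b) (sub_pos.1 h).le]
    refine neg_nonneg.2 (div_nonpos_of_nonpos_of_nonneg ?_ (by positivity))
    have : (-b) ^ 3 - lam * -b = -(b ^ 3 - lam * b) := by ring
    linarith [Real.cos_le_one t, hB.upper]
  have hz : (0 : ℝ) ∈ Icc 0 (Real.pi / 2) := ⟨le_rfl, hpi.le⟩
  obtain ⟨α, -, hα⟩ := intermediate_value_Icc (a := -b - 1) (b := 1) (by linarith)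
    (hcont (Real.pi / 2) hpi.le).1.continuousOn
    (show (0 : ℝ) ∈ _ from
      ⟨(below (-b - 1) 0 hz (by rw [(hU _).1]; linarith)).le.trans (neg_nonpos.2 hb0.le),
      (above 1 0 hz (by rw [(hU _).1]; exact one_pos)).le⟩)
  simp only at hα
  refine ⟨U α, U' α, (hU α).2.2, (hU α).2.1, hα, fun s hs => ⟨?_, ?_⟩⟩ <;> by_contra! h
  · linarith [below α s hs h]
  · linarith [above α s hs h]

/-- On the quarter period the quarter solution never sees which of the two clamps is used. The
symmetric clamp commutes with `u ↦ -u(π - t)`, and both functions have the same data at the zero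
`π/2`; this oddness transfers `u'(0) = 0` to `π`. -/
theorem exists_middle (hε : 0 < ε) (hB : Barriers lam m b) :
    ∃ u u' : ℝ → ℝ, IsGlobalSolution (force ε lam) u u' ∧ u' 0 = 0 ∧ u' Real.pi = 0 ∧ IsSym u ∧
      (∀ t, -b ≤ u t ∧ u t ≤ b) ∧ (∀ t, u (Real.pi - t) = -u t) ∧ u (Real.pi / 2) = 0 ∧
      ∀ t ∈ Ico 0 (Real.pi / 2), u t < 0 := by
  obtain ⟨v, v', hv, hv0, hvpi, hvb⟩ := exists_middle_quarter hε hB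
  have hb0 : 0 < b := hB.pos.trans hB.lt
  have hf := isTame_clampForce (lam := lam) hε (continuous_const (y := -b))
    (continuous_const (y := b)) (M := b) (fun _ => by rw [abs_neg, abs_of_pos hb0])
    (fun _ => by rw [abs_of_pos hb0])
  have hpi : 0 < Real.pi / 2 := by positivity
  obtain ⟨u, u', hu0, hu0', hu⟩ := hf.exists_solution (v 0)
  have huv : ∀ t ∈ Icc 0 (Real.pi / 2), u t = v t := by
    intro t ht
    have := eq_of_gronwall (d := fun t => u t - v t) (d' := fun t => u' t - v' t)
      (a := 0) (b := Real.pi / 2) hf.nonneg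
      (fun t _ => ((hu t).1.sub (hv t).1).hasDerivWithinAt)
      (fun t _ => ((hu t).2.sub (hv t).2).hasDerivWithinAt)
      (fun t ht => by
        rw [clampForce_of_mem (lo := fun _ => -b) (hi := fun _ => 0) (hvb t ht).1 (hvb t ht).2,
          ← clampForce_of_mem (lo := fun _ => -b) (hi := fun _ => b) (hvb t ht).1
            ((hvb t ht).2.trans hb0.le)]
        exact hf.lipschitz _ _ _) (by simp [hu0]) (by simp [hu0', hv0]) t ht
    exact sub_eq_zero.1 this.1
  have hupi : u (Real.pi / 2) = 0 := by rw [huv _ ⟨hpi.le, le_rfl⟩, hvpi]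
  have hanti : IsGlobalSolution (clampForce ε lam (fun _ => -b) fun _ => b)
      (fun t => -u (Real.pi - t)) (fun t => u' (Real.pi - t)) := by
    intro t
    constructor
    · simpa using (HasDerivAt.comp_neg_left Real.pi (hu (Real.pi - t)).1).fun_neg
    · convert! HasDerivAt.comp_neg_left Real.pi (hu (Real.pi - t)).2 using 1
      have : max (-b) (min (-u (Real.pi - t)) b) = -max (-b) (min (u (Real.pi - t)) b) := by
        rw [← min_neg_neg, neg_neg, ← max_neg_neg, max_min_distrib_left, max_eq_right
          (by linarith : -b ≤ b), max_comm, min_comm]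
      simp only [clampForce, force, this, Real.cos_pi_sub]
      ring
  have e : Real.pi - Real.pi / 2 = Real.pi / 2 := by ring
  have heq := fun t => hanti.eq_of_isTame hf hu (s := Real.pi / 2) (by simp [e, hupi])
    (by simp [e]) t
  have hodd : ∀ t, u (Real.pi - t) = -u t := fun t => by linarith [(heq t).1]
  have hupi' : u' Real.pi = 0 := by rw [← (heq Real.pi).2, sub_self, hu0']
  have hsym := hu.isSym hf (isSym_const _) (isSym_const _) hu0' hupi'
  have hbd : ∀ t, -b ≤ u t ∧ u t ≤ b := by
    intro t
    obtain ⟨s, hs, hts⟩ := exists_mem_Icc_isSym t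
    rw [hts _ hsym]
    rcases le_total s (Real.pi / 2) with h | h
    · have := hvb s ⟨hs.1, h⟩
      rw [huv s ⟨hs.1, h⟩]
      exact ⟨this.1, this.2.trans hb0.le⟩
    · have h' : Real.pi - s ∈ Icc 0 (Real.pi / 2) := ⟨by linarith [hs.2], by linarith⟩
      have := hvb _ h'
      rw [← huv _ h', hodd] at this
      constructor <;> linarith
  have hsol := hu.of_clampForce (fun t => (hbd t).1) (fun t => (hbd t).2)
  refine ⟨u, u', hsol, hu0', hupi', hsym, hbd, hodd, hupi, fun s hs => ?_⟩
  have hle : ∀ t ∈ Icc 0 (Real.pi / 2), u t ≤ 0 := fun t ht => by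
    rw [huv t ht]; exact (hvb t ht).2
  refine (hle s ⟨hs.1, hs.2.le⟩).lt_of_ne fun hs0 => ?_
  -- A zero before `π/2` would be a local maximum (evenness covers `s = 0`), while the equation
  -- gives `u'' = cos s / ε² > 0` there.
  have hmax : IsLocalMax u s := by
    filter_upwards [Ioo_mem_nhds (show -(Real.pi / 2) < s by linarith [hs.1]) hs.2] with t ht
    rw [hs0]
    rcases le_total 0 t with h | h
    · exact hle t ⟨h, ht.2.le⟩
    · rw [← hsym.neg]
      exact hle (-t) ⟨neg_nonneg.2 h, by linarith [ht.1]⟩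
  have hcos : 0 < Real.cos s := Real.cos_pos_of_mem_Ioo ⟨by linarith [hs.1], hs.2⟩
  obtain ⟨t, ht, hlt⟩ := exists_gt_of_deriv2_pos (fun t => (hsol t).1) (hsol s).2
    (hmax.hasDerivAt_eq_zero (hsol s).1) 
    (div_pos (by rw [hs0]; simpa using hcos) (by positivity)) hs.2
  linarith [hle t ⟨hs.1.trans ht.1.le, ht.2.le⟩]

end

/-! ### Strict ordering, symmetry and uniqueness -/

section

variable {ε lam m b : ℝ}

theorem force_le_force {t x y : ℝ} (hx : 0 < x) (hxy : x ≤ y) (h : lam ≤ 3 * x ^ 2) :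
    force ε lam t x ≤ force ε lam t y := by
  unfold force
  gcongr ?_ / _
  have : 0 ≤ (y - x) * (y ^ 2 + y * x + x ^ 2 - lam) :=
    mul_nonneg (sub_nonneg.2 hxy) (by nlinarith)
  linarith [show (y - x) * (y ^ 2 + y * x + x ^ 2 - lam) = y ^ 3 - lam * y - (x ^ 3 - lam * x) by
    ring]

theorem IsGlobalSolution.eq_of_force (hε : 0 < ε) {u u' v v' : ℝ → ℝ}
    (hu : IsGlobalSolution (force ε lam) u u') (hv : IsGlobalSolution (force ε lam) v v') {s : ℝ}
    (h0 : u s = v s) (h0' : u' s = v' s) (t : ℝ) : u t = v t := by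
  have := eq_zero_of_abs_deriv2_le (d := fun t => u t - v t) (d' := fun t => u' t - v' t)
    (d'' := fun t => force ε lam t (u t) - force ε lam t (v t)) (fun t => (hu t).1.sub (hv t).1)
    (fun t => (hu t).2.sub (hv t).2) (fun R => ?_) (s := s) (by simp [h0]) (by simp [h0']) t
  · exact sub_eq_zero.1 this.1
  obtain ⟨A, hA⟩ := (isCompact_Icc (a := -R) (b := R)).exists_bound_of_continuousOn
    hu.continuous.continuousOn
  obtain ⟨B, hB⟩ := (isCompact_Icc (a := -R) (b := R)).exists_bound_of_continuousOn
    hv.continuous.continuousOn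
  exact ⟨(3 * (max A B) ^ 2 + |lam|) / ε ^ 2, by positivity, fun t ht => abs_force_sub_le hε
    ((hA t (abs_le.1 ht)).trans (le_max_left _ _)) ((hB t (abs_le.1 ht)).trans (le_max_right _ _))⟩

/-- Ordered solutions can only touch tangentially, and then they coincide. -/
theorem IsGlobalSolution.lt_of_le (hε : 0 < ε) {u u' v v' : ℝ → ℝ}
    (hu : IsGlobalSolution (force ε lam) u u') (hv : IsGlobalSolution (force ε lam) v v')
    (hle : ∀ t, u t ≤ v t) (hne : u 0 ≠ v 0) (t : ℝ) : u t < v t := by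
  refine (hle t).lt_of_ne fun h => hne ?_
  have hmin : IsLocalMin (fun s => v s - u s) t :=
    Eventually.of_forall fun s => by simpa [h] using hle s
  have := hmin.hasDerivAt_eq_zero ((hv t).1.sub (hu t).1)
  exact hu.eq_of_force hε hv h (sub_eq_zero.1 this).symm 0

theorem IsGlobalSolution.neg_shift {u u' : ℝ → ℝ} (hu : IsGlobalSolution (force ε lam) u u') :
    IsGlobalSolution (force ε lam) (fun t => -u (t + Real.pi)) (fun t => -u' (t + Real.pi)) := by
  intro t
  obtain ⟨h1, h2⟩ := hu (t + Real.pi)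
  refine ⟨(h1.comp_add_const t Real.pi).fun_neg, ?_⟩
  convert! (h2.comp_add_const t Real.pi).fun_neg using 1
  simp only [force, Real.cos_add_pi]
  ring

/-- A convex function lies above its tangents, and a tangent with nonzero slope is unbounded above
on the line. -/
theorem deriv_eq_zero_of_convex_bounded {q q' q'' : ℝ → ℝ} (hq : ∀ t, HasDerivAt q (q' t) t)
    (hq' : ∀ t, HasDerivAt q' (q'' t) t) (hnn : ∀ t, 0 ≤ q'' t) {M : ℝ} (hM : ∀ t, q t ≤ M)
    (s : ℝ) : q' s = 0 := by
  have hmono : Monotone q' := monotone_of_hasDerivAt_nonneg hq' hnn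
  have htan : ∀ t, q s + q' s * (t - s) ≤ q t := by
    intro t
    have hc : Continuous q := continuous_iff_continuousAt.2 fun t => (hq t).continuousAt
    rcases lt_trichotomy s t with h | h | h
    · obtain ⟨c, hc, he⟩ := exists_hasDerivAt_eq_slope q q' h hc.continuousOn fun x _ => hq x
      rw [eq_div_iff (sub_pos.2 h).ne'] at he
      nlinarith [hmono hc.1.le]
    · simp [h]
    · obtain ⟨c, hc, he⟩ := exists_hasDerivAt_eq_slope q q' h hc.continuousOn fun x _ => hq x
      rw [eq_div_iff (sub_pos.2 h).ne'] at he
      nlinarith [hmono hc.2.le]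
  by_contra hne
  have h1 := htan (s + (M - q s + 1) / q' s)
  rw [add_sub_cancel_left, mul_div_cancel₀ _ hne] at h1
  linarith [hM (s + (M - q s + 1) / q' s)]

/-- The difference `d` satisfies `d'' = c d` with `c > 0`, so `d²` is convex and bounded. Its slope
vanishes identically, hence so does `d'² + c d²`. -/
theorem upper_unique (hε : 0 < ε) {u u' v v' : ℝ → ℝ} {A B : ℝ}
    (hu : IsGlobalSolution (force ε lam) u u') (hv : IsGlobalSolution (force ε lam) v v')
    (hub : ∀ t, |u t| ≤ A) (hvb : ∀ t, |v t| ≤ B) (hup : ∀ t, 0 < u t ∧ 0 < 3 * u t ^ 2 - lam)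
    (hvp : ∀ t, 0 < v t ∧ 0 < 3 * v t ^ 2 - lam) : u = v := by
  set c : ℝ → ℝ := fun t => (u t ^ 2 + u t * v t + v t ^ 2 - lam) / ε ^ 2 with hc
  have hcpos : ∀ t, 0 < c t := by
    intro t
    obtain ⟨h1, h2⟩ := hup t
    obtain ⟨h3, h4⟩ := hvp t
    refine div_pos ?_ (by positivity)
    rcases le_total (u t) (v t) with h | h <;> nlinarith
  have hd : ∀ t, HasDerivAt (fun t => u t - v t) (u' t - v' t) t := fun t => (hu t).1.sub (hv t).1
  have hd' : ∀ t, HasDerivAt (fun t => u' t - v' t) (c t * (u t - v t)) t := fun t => by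
    convert! (hu t).2.sub (hv t).2 using 1
    simp only [hc, force]
    field_simp
    ring
  have hq : ∀ t, HasDerivAt (fun t => (u t - v t) * (u t - v t))
      (2 * ((u t - v t) * (u' t - v' t))) t := fun t => by
    convert! (hd t).mul (hd t) using 1
    ring
  have hq' : ∀ t, HasDerivAt (fun t => 2 * ((u t - v t) * (u' t - v' t)))
      (2 * ((u' t - v' t) ^ 2 + c t * (u t - v t) ^ 2)) t := fun t => by
    convert! ((hd t).mul (hd' t)).const_mul 2 using 1
    ring
  have hz := deriv_eq_zero_of_convex_bounded hq hq'
    (fun t => by have := (hcpos t).le; positivity) (M := (A + B) * (A + B)) fun t => by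
      have h1 : |u t - v t| ≤ A + B := (abs_sub _ _).trans (add_le_add (hub t) (hvb t))
      rw [← abs_mul_abs_self]
      exact mul_self_le_mul_self (abs_nonneg _) h1
  funext t
  have h1 := hq' t
  rw [show (fun t => 2 * ((u t - v t) * (u' t - v' t))) = fun _ => 0 from funext hz] at h1
  have h2 := h1.unique (hasDerivAt_const t 0)
  have h3 := hcpos t
  have h4 : 0 ≤ c t * (u t - v t) ^ 2 := by positivity
  have h5 : c t * (u t - v t) ^ 2 = 0 := by nlinarith [sq_nonneg (u' t - v' t)]
  exact sub_eq_zero.1 (pow_eq_zero_iff two_ne_zero |>.1 ((mul_eq_zero.1 h5).resolve_left h3.ne'))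

/-- Solutions bounded by `b` with Neumann data at `0` and `π` stay below the upper solution. -/
theorem le_upper (hB : Barriers lam m b) {u u' v v' : ℝ → ℝ}
    (hu : IsGlobalSolution (force ε lam) u u') (hv : IsGlobalSolution (force ε lam) v v')
    (hupi : u' Real.pi = 0) (hvpi : v' Real.pi = 0) (hus : IsSym u) (hvs : IsSym v)
    (hvm : ∀ t, m ≤ v t) (h0 : u 0 ≤ v 0) (t : ℝ) : u t ≤ v t := by
  obtain ⟨s, hs, hts⟩ := exists_mem_Icc_isSym t
  rw [hts u hus, hts v hvs]
  by_contra! h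
  have := (escape_of_nonpos (d := fun t => u t - v t) (fun t => (hu t).1.sub (hv t).1)
    (fun t => (hu t).2.sub (hv t).2)
    (fun t _ ht => sub_nonneg.2 (force_le_force (hB.pos.trans_le (hvm t)) (sub_pos.1 ht).le
      (by have := pow_le_pow_left₀ hB.pos.le (hvm t) 2; linarith [hB.deriv_pos])))
    (sub_nonpos.2 h0) hs (sub_pos.2 h)).2
  simp [hupi, hvpi] at this

/-! ### The fourth solution -/

/-- Shooting between two ordered solutions, the upper one of which is stable. -/
theorem exists_solution_between (hε : 0 < ε) (hB : Barriers lam m b) {lo lo' hi hi' : ℝ → ℝ}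
    (hlo : IsGlobalSolution (force ε lam) lo lo') (hhi : IsGlobalSolution (force ε lam) hi hi')
    (hlopi : lo' Real.pi = 0) (hhi0 : hi' 0 = 0) (hhipi : hi' Real.pi = 0)
    (hlos : IsSym lo) (hhis : IsSym hi) (hlob : ∀ t, |lo t| ≤ b) (hhib : ∀ t, |hi t| ≤ b)
    (hhim : ∀ t, m ≤ hi t) (hle : ∀ t, lo t ≤ hi t) {a T : ℝ} (hT : T ∈ Ioo 0 Real.pi)
    {w w' : ℝ → ℝ} (hw : IsSolutionOn ε lam (Icc 0 T) w w') (hw0 : w 0 = a) (hw0' : w' 0 = 0)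
    (hwlo : ∀ t ∈ Icc 0 T, lo t ≤ w t) (hwhi : ∀ t ∈ Icc 0 T, w t ≤ hi t) (hwT : w T = hi T)
    (hloa : lo 0 < a) (hahi : a < hi 0) :
    ∃ u u' : ℝ → ℝ, IsGlobalSolution (force ε lam) u u' ∧ u' 0 = 0 ∧ u' Real.pi = 0 ∧ IsSym u ∧
      (∀ t, lo t < u t) ∧ ∀ t, u t < hi t := by
  have hf := isTame_clampForce (lam := lam) hε hlo.continuous hhi.continuous hlob hhib
  obtain ⟨U, U', hU, hlip, hcont⟩ := hf.exists_family
  have hpi := Real.pi_pos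
  have hhic : IsGlobalSolution (clampForce ε lam lo hi) hi hi' := fun t =>
    ⟨(hhi t).1, by rw [clampForce_of_mem (hle t) le_rfl]; exact (hhi t).2⟩
  have hUhi : ∀ t, U (hi 0) t = hi t := fun t =>
    ((hU _).2.2.eq_of_isTame hf hhic (s := 0) (hU _).1 (by rw [(hU _).2.1, hhi0]) t).1
  have above : ∀ α ≤ hi 0, ∀ s ∈ Icc 0 Real.pi, hi s < U α s → 0 < U' α Real.pi := by
    intro α hα s hs h
    have := (escape_of_nonpos (d := fun t => U α t - hi t)
      (fun t => ((hU α).2.2 t).1.sub (hhi t).1) (fun t => ((hU α).2.2 t).2.sub (hhi t).2)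
      -- Above `hi` the frozen force equals `hi''`, so the difference is affine there; no sign of
      -- the force is needed.
      (fun t _ ht => by rw [clampForce_of_ge (hle t) (sub_pos.1 ht).le, sub_self])
      (sub_nonpos.2 (by rw [(hU α).1]; exact hα)) hs (sub_pos.2 h)).2
    simpa [hhipi] using this
  have below : ∀ α, lo 0 ≤ α → ∀ s ∈ Icc 0 Real.pi, U α s < lo s → U' α Real.pi < 0 := by
    intro α hα s hs h
    have := (escape_of_nonpos (d := fun t => lo t - U α t)
      (fun t => (hlo t).1.sub ((hU α).2.2 t).1) (fun t => (hlo t).2.sub ((hU α).2.2 t).2)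
      (fun t _ ht => by rw [clampForce_of_le (sub_pos.1 ht).le, sub_self])
      (sub_nonpos.2 (by rw [(hU α).1]; exact hα)) hs (sub_pos.2 h)).2
    simpa [hlopi] using this
  -- A negative final slope would keep this shot below `hi` throughout. It follows `w` up to `T`, so
  -- it would touch `hi` tangentially and coincide with it, against `a < hi 0`.
  have hφa : 0 ≤ U' a Real.pi := by
    by_contra! hneg
    have hb : ∀ s ∈ Icc 0 Real.pi, U a s ≤ hi s := fun s hs => by
      by_contra! h
      linarith [above a hahi.le s hs h]
    have hUT : U a T = hi T := by
      have := eq_of_gronwall (d := fun t => U a t - w t) (d' := fun t => U' a t - w' t)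
        (a := 0) (b := T) hf.nonneg
        (fun t ht => ((hU a).2.2 t).1.hasDerivWithinAt.sub (hw t ht).1)
        (fun t ht => ((hU a).2.2 t).2.hasDerivWithinAt.sub (hw t ht).2)
        (fun t ht => by
          have := hf.lipschitz t (U a t) (w t)
          rwa [clampForce_of_mem (hwlo t ht) (hwhi t ht)] at this)
        (by rw [(hU a).1, hw0, sub_self]) (by rw [(hU a).2.1, hw0', sub_self]) T ⟨hT.1.le, le_rfl⟩
      rw [← hwT]
      exact sub_eq_zero.1 this.1
    have hmin : IsLocalMin (fun s => hi s - U a s) T := by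
      filter_upwards [Icc_mem_nhds hT.1 hT.2] with s hs
      simpa [hUT] using hb s hs
    have hder := hmin.hasDerivAt_eq_zero ((hhi T).1.sub ((hU a).2.2 T).1)
    have := ((hU a).2.2.eq_of_isTame hf hhic hUT (sub_eq_zero.1 hder).symm 0).1
    rw [(hU a).1] at this
    exact hahi.ne this
  obtain ⟨β, haβ, hβ, hφβ⟩ : ∃ β, a ≤ β ∧ β < hi 0 ∧ U' β Real.pi ≤ 0 := by
    have hrm : Real.sqrt (lam / 3) < m := (Real.sqrt_lt' hB.pos).2 (by linarith [hB.deriv_pos])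
    obtain ⟨r, hr, hrm⟩ := exists_between hrm
    have hr0 : 0 < r := (Real.sqrt_nonneg _).trans_lt hr
    have hr3 : lam ≤ 3 * r ^ 2 := by linarith [(Real.sqrt_lt' hr0).1 hr]
    set E := Real.exp (((3 * b ^ 2 + |lam|) / ε ^ 2 + 1) * Real.pi) with hE
    have hE0 : 0 < E := Real.exp_pos _
    -- The Gronwall factor is at most `E` on `[0, π]`, so a shot from `δ` below `hi` stays above `r
    -- > √(lam/3)`, where the force is monotone; the second term keeps the start at or above `a`.
    set δ := min ((m - r) / E) (hi 0 - a) with hδ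
    have hδ0 : 0 < δ := lt_min (div_pos (sub_pos.2 hrm) hE0) (sub_pos.2 hahi)
    have hlow : ∀ t ∈ Icc 0 Real.pi, r ≤ U (hi 0 - δ) t := by
      intro t ht
      have h1 := hlip (hi 0 - δ) (hi 0) t ht.1
      rw [hUhi, sub_sub_cancel_left, abs_neg, abs_of_pos hδ0] at h1
      have h2 : δ * Real.exp (((3 * b ^ 2 + |lam|) / ε ^ 2 + 1) * t) ≤ δ * E := by
        rw [hE]
        gcongr
        exact ht.2
      have h3 : δ * E ≤ m - r := (le_div_iff₀ hE0).1 (min_le_left _ _)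
      linarith [(abs_le.1 h1).1, hhim t]
    refine ⟨hi 0 - δ, by linarith [min_le_right ((m - r) / E) (hi 0 - a)], by linarith, ?_⟩
    -- Monotonicity of the force makes the gap below `hi` convex, so its slope at `π` is at least
    -- its slope `0` at the start.
    have := (escape (d := fun t => hi t - U (hi 0 - δ) t)
      (fun t => (hhi t).1.sub ((hU _).2.2 t).1) (fun t => (hhi t).2.sub ((hU _).2.2 t).2)
      (a := 0) (e := Real.pi) (fun t ht h => sub_nonneg.2 ?_) le_rfl
      (by rw [(hU _).1]; linarith) (by rw [(hU _).2.1, hhi0, sub_self]) Real.pi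
      ⟨hpi.le, le_rfl⟩).2
    · rw [(hU _).2.1, hhi0, hhipi] at this
      linarith
    · have hrc : r ≤ max (lo t) (min (U (hi 0 - δ) t) (hi t)) :=
        le_max_of_le_right (le_min (hlow t ht) (hrm.le.trans (hhim t)))
      refine force_le_force (hr0.trans_le hrc) (max_le (hle t) (min_le_right _ _)) ?_
      have := pow_le_pow_left₀ hr0.le hrc 2
      linarith
  obtain ⟨α, hα, hφ⟩ := intermediate_value_Icc' haβ (hcont Real.pi hpi.le).2.continuousOn
    (show (0 : ℝ) ∈ _ from ⟨hφβ, hφa⟩)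
  simp only at hφ
  have hloα : lo 0 < α := hloa.trans_le hα.1
  have hαhi : α < hi 0 := hα.2.trans_lt hβ
  have hsym := (hU α).2.2.isSym hf hlos hhis (hU α).2.1 hφ
  have hbd : ∀ t, lo t ≤ U α t ∧ U α t ≤ hi t := by
    intro t
    obtain ⟨s, hs, hts⟩ := exists_mem_Icc_isSym t
    rw [hts _ hsym, hts _ hlos, hts _ hhis]
    constructor <;> by_contra! h
    · exact (below α hloα.le s hs h).ne hφ
    · exact (above α hαhi.le s hs h).ne' hφ
  have hsol := (hU α).2.2.of_clampForce (fun t => (hbd t).1) (fun t => (hbd t).2)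
  exact ⟨U α, U' α, hsol, (hU α).2.1, hφ, hsym,
    hlo.lt_of_le hε hsol (fun t => (hbd t).1) (by rw [(hU α).1]; exact hloα.ne),
    hsol.lt_of_le hε hhi (fun t => (hbd t).2) (by rw [(hU α).1]; exact hαhi.ne)⟩

/-! ### Condition A and the characterisations of the named solutions -/

theorem IsSolution.isGlobalSolution {u : ℝ → ℝ} (h : IsSolution ε lam u) :
    IsGlobalSolution (force ε lam) u (deriv u) := fun t =>
  ⟨hasDerivWithinAt_univ.1 (h t trivial).1, hasDerivWithinAt_univ.1 (h t trivial).2⟩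

theorem IsGlobalSolution.deriv_eq {f : ℝ → ℝ → ℝ} {u u' : ℝ → ℝ} (h : IsGlobalSolution f u u') :
    deriv u = u' := funext fun t => (h t).1.deriv

theorem IsGlobalSolution.isSolution {u u' : ℝ → ℝ} (h : IsGlobalSolution (force ε lam) u u') :
    IsSolution ε lam u := by
  intro t _
  rw [h.deriv_eq]
  exact ⟨(h t).1.hasDerivWithinAt, (h t).2.hasDerivWithinAt⟩

theorem IsGlobalSolution.isSolutionOn {u u' : ℝ → ℝ} (h : IsGlobalSolution (force ε lam) u u')
    (s : Set ℝ) : IsSolutionOn ε lam s u u' := fun t _ =>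
  ⟨(h t).1.hasDerivWithinAt, (h t).2.hasDerivWithinAt⟩

/-- Needed because shifting by `π` moves the Neumann condition at `π` to `2π`. -/
theorem IsGlobalSolution.deriv_two_pi {f : ℝ → ℝ → ℝ} {u u' : ℝ → ℝ}
    (h : IsGlobalSolution f u u') (hs : IsSym u) (h0 : u' 0 = 0) : u' (2 * Real.pi) = 0 := by
  have h1 := HasDerivAt.comp_neg_left (t := 0) (2 * Real.pi) (h _).1
  rw [show (fun s => u (2 * Real.pi - s)) = u from funext hs.reflect, sub_zero] at h1
  have := h1.unique (h 0).1
  linarith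

/-- The solution from Condition A, cut off where it meets the upper solution, lies in the strip
between the middle and the upper solution. -/
theorem ConditionA.exists_crossing (hε : 0 < ε) (hb : 0 < b) (hA : ConditionA ε lam b)
    {lo lo' hi : ℝ → ℝ} (hlo : IsGlobalSolution (force ε lam) lo lo') (hlo0 : lo' 0 = 0)
    (hlob : ∀ t, -b ≤ lo t) (hlon : ∀ t ∈ Ico 0 (Real.pi / 2), lo t < 0)
    (hhi : Continuous hi) (hhib : ∀ t, 0 < hi t ∧ hi t ≤ b) :
    ∃ a T, T ∈ Ioo 0 Real.pi ∧ ∃ w w' : ℝ → ℝ, IsSolutionOn ε lam (Icc 0 T) w w' ∧ w 0 = a ∧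
      w' 0 = 0 ∧ (∀ t ∈ Icc 0 T, lo t ≤ w t) ∧ (∀ t ∈ Icc 0 T, w t ≤ hi t) ∧ w T = hi T ∧
      lo 0 < a ∧ a < hi 0 := by
  obtain ⟨a, ha, T, hT, w, w', hw, hw0, hw0', hmono, hwT⟩ := hA
  have ha0 : a < 0 := ha.2.trans_le (neg_nonpos.2 (Real.sqrt_nonneg _))
  have hwc : ContinuousOn w (Icc 0 T) := fun t ht => (hw t ht).1.continuousWithinAt
  -- Up to its first zero `c` the solution `w` is negative and the Wronskian comparison applies;
  -- from then on `w ≥ 0 > lo` by monotonicity.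
  obtain ⟨c, hc, hc0, hcn⟩ := exists_first_zero (g := fun t => -w t) hwc.neg hT.1.le
    (by simpa [hw0] using ha0) (by simpa [hwT] using hb.le)
  have hc0 : w c = 0 := neg_eq_zero.1 hc0
  have hcn : ∀ t ∈ Ico 0 c, w t < 0 := fun t ht => neg_pos.1 (hcn t ht)
  have hcpi : c < Real.pi / 2 := hc.2.trans_lt hT.2
  have hsub : Icc 0 c ⊆ Icc 0 T := Icc_subset_Icc_right hc.2
  have hwon : IsSolutionOn ε lam (Icc 0 c) w w' := fun t ht =>
    ⟨(hw t (hsub ht)).1.mono hsub, (hw t (hsub ht)).2.mono hsub⟩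
  have hloc := hlon c ⟨hc.1.le, hcpi⟩
  have hcmp := le_of_negative_solutions hε hcpi.le hwon (hlo.isSolutionOn _) hw0' hlo0 hcn
    (fun t ht => hlon t ⟨ht.1, ht.2.trans hcpi⟩) hc0.le (by rw [hc0]; exact hloc.le)
  have hwlo : ∀ t ∈ Icc 0 T, lo t ≤ w t := by
    intro t ht
    rcases le_total t c with h | h
    · exact hcmp t ⟨ht.1, h⟩
    · have := hmono.monotoneOn ⟨hc.1.le, hc.2⟩ ht h
      rw [hc0] at this
      exact (hlon t ⟨ht.1, ht.2.trans_lt hT.2⟩).le.trans this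
  have hloa : lo 0 < a := by
    -- Equal starts would make `lo` and `w` agree up to `c`, where `w` vanishes and `lo` is
    -- negative.
    refine lt_of_le_of_ne (hw0 ▸ hwlo 0 ⟨le_rfl, hT.1.le⟩) fun h => ?_
    have := eq_of_gronwall (d := fun t => lo t - w t) (d' := fun t => lo' t - w' t)
      (d'' := fun t => force ε lam t (lo t) - force ε lam t (w t))
      (a := 0) (b := c) (K := (3 * b ^ 2 + |lam|) / ε ^ 2) (by positivity)
      (fun t ht => (hlo t).1.hasDerivWithinAt.sub (hwon t ht).1)
      (fun t ht => (hlo t).2.hasDerivWithinAt.sub (hwon t ht).2)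
      (fun t ht => by
        have hw0 : w t ≤ 0 := by
          rcases ht.2.lt_or_eq with h | h
          · exact (hcn t ⟨ht.1, h⟩).le
          · rw [h, hc0]
        have := hlob t
        have := hcmp t ht
        exact abs_force_sub_le hε (abs_le.2 ⟨by linarith, by linarith⟩)
          (abs_le.2 ⟨by linarith, by linarith⟩))
      (by rw [h, hw0, sub_self]) (by rw [hlo0, hw0', sub_self]) c ⟨hc.1.le, le_rfl⟩
    have := this.1
    rw [hc0] at this
    linarith
  have hahi : a < hi 0 := ha0.trans (hhib 0).1
  -- Since `hi T ≤ b = w T`, there is a first meeting with `hi`; the solution is cut there so that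
  -- it stays below `hi`.
  obtain ⟨S, hS, hS0, hSp⟩ := exists_first_zero (g := fun t => hi t - w t)
    (hhi.continuousOn.sub hwc) hT.1.le (by rw [hw0]; exact sub_pos.2 hahi)
    (by rw [hwT]; exact sub_nonpos.2 (hhib T).2)
  have hsubS : Icc 0 S ⊆ Icc 0 T := Icc_subset_Icc_right hS.2
  have hwS : w S = hi S := (sub_eq_zero.1 hS0).symm
  refine ⟨a, S, ⟨hS.1, by linarith [hS.2, hT.2, Real.pi_pos]⟩, w, w', fun t ht =>
    ⟨(hw t (hsubS ht)).1.mono hsubS, (hw t (hsubS ht)).2.mono hsubS⟩, hw0, hw0',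
    fun t ht => hwlo t (hsubS ht), fun t ht => ?_, hwS, hloa, hahi⟩
  rcases ht.2.lt_or_eq with h | h
  · exact (sub_pos.1 (hSp t ⟨ht.1, h⟩)).le
  · rw [h, hwS]

theorem IsMiddleSolution.neg {u : ℝ → ℝ} (h : IsMiddleSolution ε lam u) :
    ∀ t ∈ Ico 0 (Real.pi / 2), u t < 0 := by
  intro t ht
  have := strictMonoOn_of_hasDerivWithinAt_pos (convex_Icc 0 (Real.pi / 2))
    h.1.isGlobalSolution.continuous.continuousOn
    (fun t _ => (h.1.isGlobalSolution t).1.hasDerivWithinAt)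
    (fun t ht => h.2.2.2 t (by rwa [interior_Icc] at ht))
    ⟨ht.1, ht.2.le⟩ ⟨ht.1.trans ht.2.le, le_rfl⟩ ht.2
  rwa [h.2.2.1] at this

/-- Both are negative before their common zero `π/2`, so the Wronskian comparison applies in both
directions and the initial data agree. -/
theorem IsMiddleSolution.unique (hε : 0 < ε) {u v : ℝ → ℝ} (hu : IsMiddleSolution ε lam u)
    (hv : IsMiddleSolution ε lam v) : u = v := by
  have hpi : 0 < Real.pi / 2 := by positivity
  have key : ∀ {u v : ℝ → ℝ}, IsMiddleSolution ε lam u → IsMiddleSolution ε lam v → v 0 ≤ u 0 := by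
    intro u v hu hv
    exact le_of_negative_solutions hε le_rfl (hu.1.isGlobalSolution.isSolutionOn _)
      (hv.1.isGlobalSolution.isSolutionOn _) hu.2.1 hv.2.1 hu.neg hv.neg hu.2.2.1.le
      (by rw [hu.2.2.1, hv.2.2.1]) 0 ⟨le_rfl, hpi.le⟩
  exact funext (hu.1.isGlobalSolution.eq_of_force hε hv.1.isGlobalSolution
    (le_antisymm (key hv hu) (key hu hv)) (by rw [hu.2.1, hv.2.1]))

theorem IsUpperSolution.unique (hε : 0 < ε) {u v : ℝ → ℝ} (hu : IsUpperSolution ε lam u)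
    (hv : IsUpperSolution ε lam v) : u = v := by
  obtain ⟨⟨h1, A, hA⟩, h2⟩ := hu
  obtain ⟨⟨h3, B, hB⟩, h4⟩ := hv
  exact upper_unique hε h1.isGlobalSolution h3.isGlobalSolution hA hB h2 h4

theorem IsLowerSolution.neg_shift {u : ℝ → ℝ} (h : IsLowerSolution ε lam u) :
    IsUpperSolution ε lam fun t => -u (t + Real.pi) := by
  obtain ⟨⟨h1, A, hA⟩, h2⟩ := h
  exact ⟨⟨h1.isGlobalSolution.neg_shift.isSolution, A, fun t => by simpa using hA _⟩,
    fun t => ⟨by simpa using (h2 _).1, by simpa using (h2 (t + Real.pi)).2⟩⟩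

theorem IsUpperSolution.neg_shift {u : ℝ → ℝ} (h : IsUpperSolution ε lam u) :
    IsLowerSolution ε lam fun t => -u (t + Real.pi) := by
  obtain ⟨⟨h1, A, hA⟩, h2⟩ := h
  exact ⟨⟨h1.isGlobalSolution.neg_shift.isSolution, A, fun t => by simpa using hA _⟩,
    fun t => ⟨by simpa using (h2 _).1, by simpa using (h2 (t + Real.pi)).2⟩⟩

end

/-- What the theorem asserts of each single solution. -/
theorem IsGlobalSolution.neumann {ε lam : ℝ} {u u' : ℝ → ℝ}
    (h : IsGlobalSolution (force ε lam) u u') (hs : IsSym u) (h0 : u' 0 = 0)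
    (hpi : u' Real.pi = 0) : IsSolution ε lam u ∧ Function.Periodic u (2 * Real.pi) ∧
      deriv u 0 = 0 ∧ deriv u Real.pi = 0 :=
  ⟨h.isSolution, hs.periodic, by rw [h.deriv_eq, h0], by rw [h.deriv_eq, hpi]⟩

theorem IsGlobalSolution.neumann_neg_shift {ε lam : ℝ} {u u' : ℝ → ℝ}
    (h : IsGlobalSolution (force ε lam) u u') (hs : IsSym u) (h0 : u' 0 = 0)
    (hpi : u' Real.pi = 0) : IsSolution ε lam (fun t => -u (t + Real.pi)) ∧
      Function.Periodic (fun t => -u (t + Real.pi)) (2 * Real.pi) ∧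
      deriv (fun t => -u (t + Real.pi)) 0 = 0 ∧ deriv (fun t => -u (t + Real.pi)) Real.pi = 0 := by
  refine ⟨h.neg_shift.isSolution, fun t => ?_, ?_, ?_⟩
  · simp only [add_right_comm t, hs.periodic (t + Real.pi)]
  · simp [h.neg_shift.deriv_eq, hpi]
  · simp [h.neg_shift.deriv_eq, ← two_mul, h.deriv_two_pi hs h0]

end Duffing

theorem mainTheorem3 (ε lam b : ℝ) (hε : 0 < ε)
    (hlam : (3 : ℝ) / (2 : ℝ) ^ ((2 : ℝ) / 3) < lam)
    (hb : 0 < b) (hb' : 0 < b ^ 3 - lam * b - 1)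
    (hA : Duffing.ConditionA ε lam b) :
    ∃ u₁ u₂ u₃ u₄ u₅ : ℝ → ℝ,
      (∀ u ∈ ({u₁, u₂, u₃, u₄, u₅} : Set (ℝ → ℝ)),
        Duffing.IsSolution ε lam u ∧ Function.Periodic u (2 * Real.pi) ∧
          deriv u 0 = 0 ∧ deriv u Real.pi = 0) ∧
      (∀ t, u₁ t < u₂ t ∧ u₂ t < u₃ t ∧ u₃ t < u₄ t ∧ u₄ t < u₅ t) ∧
      (∀ w, Duffing.IsLowerSolution ε lam w ↔ w = u₁) ∧
      (∀ w, Duffing.IsMiddleSolution ε lam w ↔ w = u₃) ∧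
      (∀ w, Duffing.IsUpperSolution ε lam w ↔ w = u₅) ∧
      (∀ t, u₄ t = -u₂ (t + Real.pi)) := by
  obtain ⟨m, hB⟩ := Duffing.exists_barriers hlam hb hb'
  obtain ⟨u₅, u₅', h₅, h₅0, h₅pi, h₅s, h₅b⟩ := Duffing.exists_upper hε hB
  obtain ⟨u₃, u₃', h₃, h₃0, h₃pi, h₃s, h₃b, h₃odd, h₃z, h₃n⟩ := Duffing.exists_middle hε hB
  have h₅p : ∀ t, 0 < u₅ t := fun t => hB.pos.trans_le (h₅b t).1
  have h₃₅ := Duffing.le_upper hB h₃ h₅ h₃pi h₅pi h₃s h₅s (fun t => (h₅b t).1)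
    ((h₃n 0 ⟨le_rfl, by positivity⟩).trans (h₅p 0)).le
  obtain ⟨a, T, hT, w, w', hw, hw0, hw0', hwlo, hwhi, hwT, hloa, hahi⟩ :=
    hA.exists_crossing hε hb h₃ h₃0 (fun t => (h₃b t).1) h₃n h₅.continuous
      fun t => ⟨h₅p t, (h₅b t).2⟩
  obtain ⟨u₄, u₄', h₄, h₄0, h₄pi, h₄s, h₃₄, h₄₅⟩ := Duffing.exists_solution_between hε hB h₃ h₅ h₃pi h₅0 h₅pi
    h₃s h₅s (fun t => abs_le.2 (h₃b t))
    (fun t => by rw [abs_of_pos (h₅p t)]; exact (h₅b t).2) (fun t => (h₅b t).1) h₃₅ hT hw hw0 hw0'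
    hwlo hwhi hwT hloa hahi
  have hmid : Duffing.IsMiddleSolution ε lam u₃ := ⟨h₃.isSolution, by rw [h₃.deriv_eq, h₃0], h₃z,
    fun t ht => by rw [h₃.deriv_eq]; exact Duffing.deriv_pos_of_negative hε h₃ h₃0 h₃n h₃z t ht⟩
  have hup : Duffing.IsUpperSolution ε lam u₅ := by
    refine ⟨⟨h₅.isSolution, b, fun t => ?_⟩, fun t => ⟨h₅p t, ?_⟩⟩
    · rw [abs_of_pos (h₅p t)]; exact (h₅b t).2
    · have := pow_le_pow_left₀ hB.pos.le (h₅b t).1 2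
      linarith [hB.deriv_pos]
  -- The middle solution is fixed by `u ↦ -u(· + π)`, so `u₃ < u₄` is carried to `u₂ < u₃`.
  have h₃shift : ∀ t, u₃ (t + Real.pi) = -u₃ t := fun t => by
    rw [add_comm, ← sub_neg_eq_add, h₃odd, h₃s.neg]
  refine ⟨fun t => -u₅ (t + Real.pi), fun t => -u₄ (t + Real.pi), u₃, u₄, u₅, ?_, ?_, ?_, ?_, ?_, ?_⟩
  · rintro u (rfl | rfl | rfl | rfl | rfl)
    · exact h₅.neumann_neg_shift h₅s h₅0 h₅pi
    · exact h₄.neumann_neg_shift h₄s h₄0 h₄pi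
    · exact h₃.neumann h₃s h₃0 h₃pi
    · exact h₄.neumann h₄s h₄0 h₄pi
    · exact h₅.neumann h₅s h₅0 h₅pi
  · intro t
    refine ⟨neg_lt_neg (h₄₅ _), ?_, h₃₄ t, h₄₅ t⟩
    have := h₃₄ (t + Real.pi)
    rw [h₃shift] at this
    linarith
  · refine fun w => ⟨fun hw => funext fun t => ?_, ?_⟩
    · have := congrFun (hw.neg_shift.unique hε hup) (t - Real.pi)
      rw [sub_add_cancel] at this
      rw [← neg_eq_iff_eq_neg, this, ← h₅s.periodic]
      congr 1
      ring
    · rintro rfl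
      exact hup.neg_shift
  · exact fun w => ⟨fun hw => hw.unique hε hmid, fun h => h ▸ hmid⟩
  · exact fun w => ⟨fun hw => hw.unique hε hup, fun h => h ▸ hup⟩
  · intro t
    rw [neg_neg, ← h₄s.periodic]
    congr 1
    ring
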